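/- For a partition $\Lambda$ of a finite set of integers into blocks, let $\mathrm{Arc}(\Lambda)$ be the set of pairs $(i,j)$ such that $i<j$ are consecutive elements of one block of $\Lambda$, and let $\mathrm{Cov}(\Lambda)=\{(i,j)\in\mathrm{Arc}(\Lambda): j=i+1\}$. Put $[n]=\{1,\dots,n\}$ and $[\pm n]=\{\pm1,\dots,\pm n\}$. Let $\Pi^{\mathrm B}(n)$ (respectively $\Pi^{\mathrm D}(n)$) be the set of partitions $\Lambda$ of $\{0\}\cup[\pm n]$ (respectively of $[\pm n]$) such that $(i,j)\in\mathrm{Arc}(\Lambda)$ implies $(-j,-i)\in\mathrm{Arc}(\Lambda)$, and such that no arc has the form $(-i,i)$. For $\mathrm X\in\{\mathrm B,\mathrm D\}$ let $\widetilde{NC}{}^{\mathrm X}(n)$ be the set of $\Lambda\in\Pi^{\mathrm X}(n)$ such that whenever $(i,k),(j,l)\in\mathrm{Arc}(\Lambda)$ and $i<j<k<l$, then $(i,k)=(-l,-j)$. Define the polynomials $$\mathrm{Bell}^{\mathrm X}_n(x,y)=\sum_{\Lambda\in\Pi^{\mathrm X}(n)}x^{|\mathrm{Arc}(\Lambda)\setminus\mathrm{Cov}(\Lambda)|/2}\,y^{|\mathrm{Cov}(\Lambda)|/2},\qquad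 \mathrm{Cat}^{\mathrm X}_n(x,y)=\sum_{\Lambda\in\widetilde{NC}{}^{\mathrm X}(n)}x^{|\mathrm{Arc}(\Lambda)\setminus\mathrm{Cov}(\Lambda)|/2}\,y^{|\mathrm{Cov}(\Lambda)|/2},$$ $$\mathrm{Fe}_n(x)=\sum_{\Lambda}x^{|\mathrm{Arc}(\Lambda)|},\qquad \widetilde{\mathrm{Fe}}{}^{\mathrm B}_n(x)=\sum_{\Lambda'}x^{|\mathrm{Arc}(\Lambda')|/2},$$ where $\Lambda$ runs over the partitions of $[n]$ all of whose blocks have at least two elements, and $\Lambda'$ runs over the elements of $\Pi^{\mathrm B}(n)$ none of whose blocks contains exactly one nonzero element. Then for every integer $n\ge 0$ the following polynomial identities hold (equivalently, they hold for all elements $x,y$ of every commutative ring): 1. $\displaystyle\sum_{k=0}^n(-1)^{n-k}\binom nk(y+1)^{n-k}\,\mathrm{Bell}^{\mathrm B}_k(x,y)=\mathrm{Fe}_n(2x)$. 2. $\displaystyle\sum_{k=0}^n(-1)^{n-k}\binom nk(y+1)^{n-k}\,\mathrm{Bell}^{\mathrm D}_{k+1}(x,y)=\widetilde{\mathrm{Fe}}{}^{\mathrm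 B}_n(x)$. 3. $\displaystyle\sum_{k=0}^n(-1)^{n-k}\binom nk(y+1)^{n-k}\,\mathrm{Cat}^{\mathrm B}_k(x,y)=\binom n{n/2}x^{n/2}$ if $n$ is even, and $=0$ if $n$ is odd. 4. $\displaystyle\sum_{k=0}^n(-1)^{n-k}\binom nk(y+1)^{n-k}\,\mathrm{Cat}^{\mathrm D}_{k+1}(x,y)=\binom n{\lfloor n/2\rfloor}x^{\lceil n/2\rceil}$. -/

import Mathlib

namespace SetPart

/-- The arcs of a partition `P` of a finite set `s` of integers: the pairs `(i, j)` such that `i`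
and `j` lie in the same block and `j` is the least element of that block greater than `i`. -/
def arcs {s : Finset ℤ} (P : Finpartition s) : Finset (ℤ × ℤ) :=
  (s ×ˢ s).filter fun a =>
    ∃ B ∈ P.parts, a.1 ∈ B ∧ a.2 ∈ B ∧ a.1 < a.2 ∧ ∀ k ∈ B, a.1 < k → a.2 ≤ k

/-- The covers of a partition: its arcs of the form `(i, i + 1)`. -/
def cov {s : Finset ℤ} (P : Finpartition s) : Finset (ℤ × ℤ) :=
  (arcs P).filter fun a => a.2 = a.1 + 1

/-- `[n] = {1, …, n}`. -/
noncomputable def groundA (n : ℕ) : Finset ℤ := Finset.Icc 1 (n : ℤ)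

/-- `{0} ∪ [±n] = {-n, …, -1, 0, 1, …, n}`. -/
noncomputable def groundB (n : ℕ) : Finset ℤ := Finset.Icc (-(n : ℤ)) (n : ℤ)

/-- `[±n] = {-n, …, -1, 1, …, n}`. -/
noncomputable def groundD (n : ℕ) : Finset ℤ := (groundB n).erase 0

/-- The arc set is invariant under `(i, j) ↦ (-j, -i)`, and no arc is fixed by this map, i.e. no
arc has the form `(-i, i)`. -/
def IsSymm {s : Finset ℤ} (P : Finpartition s) : Prop :=
  (∀ a ∈ arcs P, (-a.2, -a.1) ∈ arcs P) ∧ ∀ a ∈ arcs P, a.1 ≠ -a.2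

/-- Two arcs `(i, k)`, `(j, l)` may cross (`i < j < k < l`) only if they are mirror images of each
other, i.e. `(i, k) = (-l, -j)`. -/
def IsNC {s : Finset ℤ} (P : Finpartition s) : Prop :=
  ∀ a ∈ arcs P, ∀ b ∈ arcs P, a.1 < b.1 → b.1 < a.2 → a.2 < b.2 → a = (-b.2, -b.1)

/-- Every block has at least two elements. -/
def IsFeasible {s : Finset ℤ} (P : Finpartition s) : Prop :=
  ∀ B ∈ P.parts, 2 ≤ B.card

/-- No block contains exactly one nonzero element. -/
def IsBFeasible {s : Finset ℤ} (P : Finpartition s) : Prop :=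
  ∀ B ∈ P.parts, (B.erase 0).card ≠ 1

/-- `Π^B(n)`: the type B set partitions of `{0} ∪ [±n]`. -/
noncomputable def PiB (n : ℕ) : Finset (Finpartition (groundB n)) :=
  open Classical in Finset.univ.filter IsSymm

/-- `Π^D(n)`: the type D set partitions of `[±n]`. -/
noncomputable def PiD (n : ℕ) : Finset (Finpartition (groundD n)) :=
  open Classical in Finset.univ.filter IsSymm

/-- The noncrossing elements of `Π^B(n)`. -/
noncomputable def NCB (n : ℕ) : Finset (Finpartition (groundB n)) :=
  open Classical in (PiB n).filter IsNC

/-- The noncrossing elements of `Π^D(n)`. -/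
noncomputable def NCD (n : ℕ) : Finset (Finpartition (groundD n)) :=
  open Classical in (PiD n).filter IsNC

variable {R : Type*} [CommRing R]

/-- The monomial `x^{|Arc|/2} (y/x)^{|Cov|/2} = x^{|Arc \ Cov|/2} y^{|Cov|/2}`. For the symmetric
partitions over which it is summed below, both exponents are integers, because `(i, j) ↦ (-j, -i)`
is a fixed-point-free involution of the arcs and of the covers. -/
def weight {s : Finset ℤ} (P : Finpartition s) (x y : R) : R :=
  x ^ ((arcs P \ cov P).card / 2) * y ^ ((cov P).card / 2)

/-- The value at `x, y` of the type B Bell polynomial. -/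
noncomputable def BellB (n : ℕ) (x y : R) : R := ∑ P ∈ PiB n, weight P x y

/-- The value at `x, y` of the type D Bell polynomial. -/
noncomputable def BellD (n : ℕ) (x y : R) : R := ∑ P ∈ PiD n, weight P x y

/-- The value at `x, y` of the type B Catalan (Narayana) polynomial. -/
noncomputable def CatB (n : ℕ) (x y : R) : R := ∑ P ∈ NCB n, weight P x y

/-- The value at `x, y` of the type D Catalan polynomial. -/
noncomputable def CatD (n : ℕ) (x y : R) : R := ∑ P ∈ NCD n, weight P x y

/-- The value at `x` of `Fe_n`, the sum of `x^{|Arc|}` over the feasible partitions of `[n]`. -/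
noncomputable def Fe (n : ℕ) (x : R) : R :=
  open Classical in
  ∑ P ∈ (Finset.univ : Finset (Finpartition (groundA n))).filter IsFeasible, x ^ (arcs P).card

/-- The value at `x` of the sum of `x^{|Arc|/2}` over the B-feasible elements of `Π^B(n)`. -/
noncomputable def FeTildeB (n : ℕ) (x : R) : R :=
  open Classical in
  ∑ P ∈ (PiB n).filter IsBFeasible, x ^ ((arcs P).card / 2)

end SetPart

namespace SetPart

open Finset

/-! A partition is determined by its arcs, and a symmetric one by the half `C` of its arcs `(i, j)`
with `|i| < j`, so that `|Arc| / 2 = |C|`, and likewise for covers. A shift of end points turns the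
covers of the half into loops `(v, v)` with `v > 0`. In type B the shifted sources are the nonzero
integers; in type D, started at `n + 1`, all integers occur as sources.

A loop at `v` forbids every other arc with an end point `±v` and imposes no noncrossing constraint.
A configuration on `[n]` is therefore a loop-free one whose nonzero end points have a set `T` of
absolute values, together with any set of loops in `[n] \ T`; the loops contribute `(y + 1) ^ (n -
|T|)`. An odd increasing relabelling shows that the loop-free total depends only on `|T|`. So all
four families are binomial transforms (`weakSum_eq`), and the alternating sums invert them, leaving
the loop-free configurations with full support `[n]` (`sum_weakSum`).

Without the noncrossing condition, full support means feasibility: configurations with positive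
sources are the feasible partitions of `[n]`, and those with arbitrary sources are the B-feasible
ones. To pass from positive to nonzero sources, insert arcs by increasing target. With `k` arcs
present, a new target `n + 1` has `n - k` positive sources available, against `2 * (n - k)` nonzero
ones; hence a factor 2 per arc (`sum_full_ne`).

In the noncrossing case the greatest element `N` is the target of some `(i, N)`, and the other arcs
fall into a part below `|i|` and a part with positive sources between `|i|` and `N` (`sum_adm_top`).
The resulting recursion gives Catalan numbers for positive sources, then central binomial
coefficients through `sum_centralBinom_mul_catalan`. The source 0, available only in type D,
produces the odd terms. -/

/-! ### Partitions as arc sets -/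

/-- The sets of pairs which are the arc set of a partition of `s`. -/
structure IsArcSet (s : Finset ℤ) (A : Finset (ℤ × ℤ)) : Prop where
  left_mem : ∀ a ∈ A, a.1 ∈ s
  right_mem : ∀ a ∈ A, a.2 ∈ s
  lt : ∀ a ∈ A, a.1 < a.2
  inj_left : ∀ a ∈ A, ∀ b ∈ A, a.1 = b.1 → a = b
  inj_right : ∀ a ∈ A, ∀ b ∈ A, a.2 = b.2 → a = b

/-- Two elements are joined if one can pass from the first to the second along arcs. -/
def Joined (A : Finset (ℤ × ℤ)) : ℤ → ℤ → Prop := Relation.ReflTransGen fun i j => (i, j) ∈ A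

lemma mem_arcs {s : Finset ℤ} {P : Finpartition s} {a : ℤ × ℤ} :
    a ∈ arcs P ↔ a.2 ∈ P.part a.1 ∧ a.1 < a.2 ∧ ∀ k ∈ P.part a.1, a.1 < k → a.2 ≤ k := by
  simp only [arcs, mem_filter, mem_product]
  constructor
  · rintro ⟨-, B, hB, h1, h2, h3, h4⟩
    rw [P.part_eq_of_mem hB h1]
    exact ⟨h2, h3, h4⟩
  · rintro ⟨h1, h2, h3⟩
    have h0 : a.1 ∈ s := P.part_nonempty.1 ⟨_, h1⟩
    exact ⟨⟨h0, P.part_subset _ h1⟩, P.part a.1, P.part_mem.2 h0, P.mem_part_self.2 h0, h1, h2, h3⟩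

lemma part_eq {s : Finset ℤ} (P : Finpartition s) {i j : ℤ} (h : j ∈ P.part i) :
    P.part j = P.part i :=
  P.part_eq_of_mem (P.part_mem.2 (P.part_nonempty.1 ⟨_, h⟩)) h

lemma mem_part_symm {s : Finset ℤ} {P : Finpartition s} {i j : ℤ} (h : j ∈ P.part i) :
    i ∈ P.part j := by
  rw [part_eq P h]
  exact P.mem_part_self.2 (P.part_nonempty.1 ⟨_, h⟩)

lemma isArcSet_arcs {s : Finset ℤ} (P : Finpartition s) : IsArcSet s (arcs P) where
  left_mem a ha := P.part_nonempty.1 ⟨_, (mem_arcs.1 ha).1⟩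
  right_mem a ha := P.part_subset _ (mem_arcs.1 ha).1
  lt a ha := (mem_arcs.1 ha).2.1
  inj_left := by
    rintro ⟨i, j⟩ ha ⟨i', k⟩ hb (rfl : i = i')
    obtain ⟨h1, h2, h3⟩ := mem_arcs.1 ha
    obtain ⟨h4, h5, h6⟩ := mem_arcs.1 hb
    have := le_antisymm (h3 _ h4 h5) (h6 _ h1 h2)
    simp_all
  inj_right := by
    rintro ⟨i, j⟩ ha ⟨k, j'⟩ hb (rfl : j = j')
    obtain ⟨h1, h2, h3⟩ := mem_arcs.1 ha
    obtain ⟨h4, h5, h6⟩ := mem_arcs.1 hb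
    have h7 : P.part i = P.part k := (part_eq P h1).symm.trans (part_eq P h4)
    dsimp only at *
    have hi := mem_part_symm h1
    have hk := mem_part_symm h4
    rw [part_eq P h1] at hi
    rw [part_eq P h4] at hk
    rcases lt_trichotomy i k with h | h | h
    · have := h3 k (h7 ▸ hk) h
      omega
    · rw [h]
    · have := h6 i (h7 ▸ hi) h
      omega

lemma Joined.le {s : Finset ℤ} {A : Finset (ℤ × ℤ)} (hA : IsArcSet s A) {i j : ℤ}
    (h : Joined A i j) : i ≤ j := by
  induction h with
  | refl => exact le_rfl
  | tail _ h ih => exact ih.trans (hA.lt _ h).le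

lemma Joined.mem_part {s : Finset ℤ} {P : Finpartition s} {i j : ℤ} (hi : i ∈ s)
    (h : Joined (arcs P) i j) : j ∈ P.part i := by
  induction h with
  | refl => exact P.mem_part_self.2 hi
  | tail _ h ih =>
    have := (mem_arcs.1 h).1
    rwa [part_eq P ih] at this

lemma joined_of_mem_part {s : Finset ℤ} {P : Finpartition s} {i j : ℤ} (h : j ∈ P.part i)
    (hij : i ≤ j) : Joined (arcs P) i j := by
  generalize hm : (j - i).toNat = m
  induction m using Nat.strong_induction_on generalizing i with
  | _ m ih =>
    rcases hij.eq_or_lt with rfl | hlt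
    · exact .refl
    have hne : ((P.part i).filter (i < ·)).Nonempty := ⟨j, by simp [h, hlt]⟩
    obtain ⟨h1, h2⟩ := mem_filter.1 (min'_mem _ hne)
    have h3 : ∀ k ∈ P.part i, i < k → ((P.part i).filter (i < ·)).min' hne ≤ k :=
      fun k hk hik => min'_le _ _ (by simp [hk, hik])
    generalize ((P.part i).filter (i < ·)).min' hne = m' at *
    have h4 : m' ≤ j := h3 j h hlt
    refine .head (b := m') (mem_arcs.2 ⟨h1, h2, h3⟩) (ih (j - m').toNat (by omega) ?_ h4 rfl)
    rwa [part_eq P h1]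

lemma mem_part_iff {s : Finset ℤ} {P : Finpartition s} {i j : ℤ} (hi : i ∈ s) (hj : j ∈ s) :
    j ∈ P.part i ↔ Joined (arcs P) i j ∨ Joined (arcs P) j i := by
  constructor
  · intro h
    rcases le_total i j with h' | h'
    · exact .inl (joined_of_mem_part h h')
    · exact .inr (joined_of_mem_part (mem_part_symm h) h')
  · rintro (h | h)
    · exact h.mem_part hi
    · exact mem_part_symm (h.mem_part hj)

/-- Two elements share a block exactly when a chain of arcs leads from one to the other, so the arcs
recover the blocks. -/
lemma arcs_injective {s : Finset ℤ} {P Q : Finpartition s} (h : arcs P = arcs Q) : P = Q := by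
  have key : ∀ i ∈ s, P.part i = Q.part i := by
    intro i hi
    ext j
    by_cases hj : j ∈ s
    · rw [mem_part_iff hi hj, mem_part_iff hi hj, h]
    · exact ⟨fun h => (hj (P.part_subset _ h)).elim, fun h => (hj (Q.part_subset _ h)).elim⟩
  have aux : ∀ P Q : Finpartition s, (∀ i ∈ s, P.part i = Q.part i) → P.parts ⊆ Q.parts := by
    intro P Q key B hB
    obtain ⟨i, hi⟩ := P.nonempty_of_mem_parts hB
    have his : i ∈ s := P.le hB hi
    rw [← P.part_eq_of_mem hB hi, key i his]
    exact Q.part_mem.2 his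
  ext1
  exact (aux P Q key).antisymm (aux Q P fun i hi => (key i hi).symm)

/-- The equivalence relation generated by an arc set. -/
def joinedSetoid {s : Finset ℤ} {A : Finset (ℤ × ℤ)} (hA : IsArcSet s A) : Setoid ℤ where
  r i j := Joined A i j ∨ Joined A j i
  iseqv :=
    { refl := fun _ => .inl .refl
      symm := fun h => h.symm
      trans := by
        -- Successors and predecessors along arcs are unique, so two paths with a common start or a
        -- common end are comparable.
        have hR : Relator.RightUnique fun i j => (i, j) ∈ A := by
          intro i j k h1 h2
          simpa using hA.inj_left _ h1 _ h2 rfl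
        have hL : Relator.RightUnique (Function.swap fun i j => (i, j) ∈ A) := by
          intro i j k h1 h2
          simpa using hA.inj_right _ h1 _ h2 rfl
        rintro i j k (h1 | h1) (h2 | h2)
        · exact .inl (h1.trans h2)
        · have := Relation.ReflTransGen.total_of_right_unique hL h1.swap h2.swap
          exact this.symm.imp (fun h => Relation.reflTransGen_swap.1 h)
            (fun h => Relation.reflTransGen_swap.1 h)
        · exact Relation.ReflTransGen.total_of_right_unique hR h1 h2
        · exact .inr (h2.trans h1) }

lemma exists_arcs_eq {s : Finset ℤ} {A : Finset (ℤ × ℤ)} (hA : IsArcSet s A) :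
    ∃ P : Finpartition s, arcs P = A := by
  classical
  refine ⟨Finpartition.ofSetSetoid (joinedSetoid hA) s, ?_⟩
  have hrel : ∀ i j, (joinedSetoid hA) i j ↔ Joined A i j ∨ Joined A j i := fun _ _ => Iff.rfl
  -- The arc `(i, j)` is the only way out of `i`, so everything reached beyond `i` is reached
  -- through `j`; this makes `j` the successor of `i` in its block.
  have hhead : ∀ i j k, (i, j) ∈ A → Joined A i k → i < k → Joined A j k := by
    intro i j k hij hik hlt
    rcases Relation.ReflTransGen.cases_head hik with rfl | ⟨m, h1, h2⟩
    · exact absurd hlt (lt_irrefl _)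
    · have := hA.inj_left _ h1 _ hij rfl
      simp only [Prod.mk.injEq, true_and] at this
      exact this ▸ h2
  ext ⟨i, j⟩
  simp only [mem_arcs, Finpartition.mem_part_ofSetSetoid_iff_rel, hrel]
  constructor
  · rintro ⟨⟨hi, hj, h⟩, hlt, hmin⟩
    have h : Joined A i j := h.resolve_right fun h => absurd (h.le hA) (not_le.2 hlt)
    rcases Relation.ReflTransGen.cases_head h with rfl | ⟨m, h1, h2⟩
    · exact absurd hlt (lt_irrefl _)
    · have := hmin m ⟨hi, hA.right_mem _ h1, .inl (.single h1)⟩ (hA.lt _ h1)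
      have h3 : m ≤ j := Joined.le hA h2
      rwa [le_antisymm this h3]
  · intro h
    refine ⟨⟨hA.left_mem _ h, hA.right_mem _ h, .inl (.single h)⟩, hA.lt _ h, ?_⟩
    rintro k ⟨-, -, h1⟩ hlt
    have h1 : Joined A i k := h1.resolve_right fun h => absurd (h.le hA) (not_le.2 hlt)
    exact (hhead i j k h h1 hlt).le hA

/-- An element lies in an arc if and only if its block is not a singleton. -/
lemma exists_arc_iff {s : Finset ℤ} {P : Finpartition s} {v : ℤ} (hv : v ∈ s) :
    (∃ a ∈ arcs P, a.1 = v ∨ a.2 = v) ↔ ∃ w ∈ P.part v, w ≠ v := by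
  constructor
  · rintro ⟨⟨i, j⟩, ha, rfl | rfl⟩
    · exact ⟨j, (mem_arcs.1 ha).1, (mem_arcs.1 ha).2.1.ne'⟩
    · exact ⟨i, mem_part_symm (mem_arcs.1 ha).1, (mem_arcs.1 ha).2.1.ne⟩
  · rintro ⟨w, hw, hne⟩
    rcases (mem_part_iff hv (P.part_subset _ hw)).1 hw with h | h
    · rcases Relation.ReflTransGen.cases_head h with rfl | ⟨m, h1, -⟩
      · exact absurd rfl hne
      · exact ⟨_, h1, .inl rfl⟩
    · rcases Relation.ReflTransGen.cases_tail h with rfl | ⟨m, -, h1⟩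
      · exact absurd rfl hne
      · exact ⟨_, h1, .inr rfl⟩

/-! ### Symmetric partitions and their halves -/

/-- `C` consists of arcs `(i, j)` with `|i| < j` and `p i`, such that `C` and its mirror image under
`(i, j) ↦ (-j, -i)` together form an arc set without arcs `(-i, i)`. If `q` holds, then moreover for
all `(i, j)` and `(k, l)` in `C` with `j < l`, either `j < |k|` or `|k| < i`. -/
structure Adm (p : ℤ → Prop) (q : Prop) (C : Finset (ℤ × ℤ)) : Prop where
  lt : ∀ c ∈ C, |c.1| < c.2
  src : ∀ c ∈ C, p c.1
  inj_left : ∀ c ∈ C, ∀ d ∈ C, c.1 = d.1 → c = d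
  inj_right : ∀ c ∈ C, ∀ d ∈ C, c.2 = d.2 → c = d
  disj : ∀ c ∈ C, ∀ d ∈ C, c.2 ≠ -d.1
  nc : q → ∀ c ∈ C, ∀ d ∈ C, c.2 < d.2 → c.2 < |d.1| ∨ |d.1| < c.1

/-- The mirror image of an arc. -/
def mirror (a : ℤ × ℤ) : ℤ × ℤ := (-a.2, -a.1)

lemma mirror_injective : Function.Injective mirror := by
  rintro ⟨a, b⟩ ⟨c, d⟩ h
  simp only [mirror, Prod.mk.injEq, neg_inj] at h
  simp [h]

/-- The symmetric arc set with the given half. -/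
def double (C : Finset (ℤ × ℤ)) : Finset (ℤ × ℤ) := C ∪ C.image mirror

/-- The half of a symmetric arc set. -/
def half (A : Finset (ℤ × ℤ)) : Finset (ℤ × ℤ) := A.filter fun a => |a.1| < a.2

lemma mem_double {C : Finset (ℤ × ℤ)} {a : ℤ × ℤ} : a ∈ double C ↔ a ∈ C ∨ mirror a ∈ C := by
  simp only [double, mem_union, mem_image]
  refine or_congr Iff.rfl ⟨?_, fun h => ⟨_, h, by simp [mirror]⟩⟩
  rintro ⟨b, hb, rfl⟩
  simpa [mirror] using hb

lemma mem_half {A : Finset (ℤ × ℤ)} {a : ℤ × ℤ} : a ∈ half A ↔ a ∈ A ∧ |a.1| < a.2 := by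
  simp [half]

/-- The condition on the half of a symmetric arc set for the arc set to be noncrossing. -/
def HalfNC (C : Finset (ℤ × ℤ)) : Prop :=
  ∀ c ∈ C, ∀ d ∈ C, c.2 < d.2 → c.2 ≤ |d.1| ∨ |d.1| ≤ c.1

/-- The halves of the symmetric arc sets on `s`. -/
noncomputable def halves (s : Finset ℤ) : Finset (Finset (ℤ × ℤ)) :=
  open Classical in (s ×ˢ s).powerset.filter (Adm (fun _ => True) False)

lemma mem_halves {s : Finset ℤ} {C : Finset (ℤ × ℤ)} :
    C ∈ halves s ↔ C ⊆ s ×ˢ s ∧ Adm (fun _ => True) False C := by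
  simp [halves]

lemma half_double {C : Finset (ℤ × ℤ)} (hC : ∀ c ∈ C, |c.1| < c.2) : half (double C) = C := by
  ext a
  rw [mem_half, mem_double]
  constructor
  · rintro ⟨h | h, hlt⟩
    · exact h
    · have := hC _ h
      simp only [mirror, abs_neg] at this
      have h1 := neg_abs_le a.1
      have h2 := le_abs_self a.2
      omega
  · exact fun h => ⟨.inl h, hC a h⟩

lemma IsSymm.double_half {s : Finset ℤ} {P : Finpartition s} (hP : IsSymm P) :
    double (half (arcs P)) = arcs P := by
  ext a
  rw [mem_double, mem_half, mem_half]
  constructor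
  · rintro (h | h)
    · exact h.1
    · simpa [mirror] using hP.1 _ h.1
  · intro h
    have h1 := hP.2 a h
    have h2 := (isArcSet_arcs P).lt a h
    rcases lt_or_ge |a.1| a.2 with h3 | h3
    · exact .inl ⟨h, h3⟩
    · refine .inr ⟨hP.1 _ h, ?_⟩
      simp only [mirror, abs_neg]
      grind

lemma IsSymm.half_mem {s : Finset ℤ} {P : Finpartition s} (hP : IsSymm P) :
    half (arcs P) ∈ halves s := by
  have hA := isArcSet_arcs P
  rw [mem_halves]
  refine ⟨fun a ha => ?_, ?_⟩
  · rw [mem_half] at ha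
    exact mem_product.2 ⟨hA.left_mem a ha.1, hA.right_mem a ha.1⟩
  · refine ⟨fun c hc => (mem_half.1 hc).2, fun _ _ => trivial,
      fun c hc d hd => hA.inj_left _ (mem_half.1 hc).1 _ (mem_half.1 hd).1,
      fun c hc d hd => hA.inj_right _ (mem_half.1 hc).1 _ (mem_half.1 hd).1, ?_, False.elim⟩
    intro c hc d hd h
    have h1 := hA.inj_right _ (mem_half.1 hc).1 _ (hP.1 _ (mem_half.1 hd).1) h
    have h2 := (mem_half.1 hc).2
    have h3 := (mem_half.1 hd).2
    rw [h1] at h2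
    simp only [abs_neg] at h2
    grind

/-- A shared source or target between an arc of `C` and a mirrored one is exactly what `disj` rules
out; two arcs on the same side are handled by the two injectivity conditions. -/
lemma isArcSet_double {s : Finset ℤ} (hs : ∀ v ∈ s, -v ∈ s) {C : Finset (ℤ × ℤ)}
    (hC : C ∈ halves s) : IsArcSet s (double C) := by
  rw [mem_halves] at hC
  obtain ⟨hsub, h⟩ := hC
  have hm : ∀ a ∈ C, a.1 ∈ s ∧ a.2 ∈ s := fun a ha => mem_product.1 (hsub ha)
  refine ⟨?_, ?_, ?_, ?_, ?_⟩
  · intro a ha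
    rcases mem_double.1 ha with ha | ha
    · exact (hm a ha).1
    · simpa [mirror] using hs _ (hm _ ha).2
  · intro a ha
    rcases mem_double.1 ha with ha | ha
    · exact (hm a ha).2
    · simpa [mirror] using hs _ (hm _ ha).1
  · intro a ha
    rcases mem_double.1 ha with ha | ha
    · have := h.lt a ha
      grind
    · have := h.lt _ ha
      simp only [mirror] at this
      grind
  · intro a ha b hb hab
    rcases mem_double.1 ha with ha | ha <;> rcases mem_double.1 hb with hb | hb
    · exact h.inj_left a ha b hb hab
    · exact absurd (by simp [mirror, hab]) (h.disj _ hb a ha)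
    · exact absurd (by simp [mirror, hab]) (h.disj _ ha b hb)
    · exact mirror_injective (h.inj_right _ ha _ hb (by simp [mirror, hab]))
  · intro a ha b hb hab
    rcases mem_double.1 ha with ha | ha <;> rcases mem_double.1 hb with hb | hb
    · exact h.inj_right a ha b hb hab
    · exact absurd (by simp [mirror, hab]) (h.disj a ha _ hb)
    · exact absurd (by simp [mirror, hab]) (h.disj b hb _ ha)
    · exact mirror_injective (h.inj_left _ ha _ hb (by simp [mirror, hab]))

lemma exists_arcs_eq_double {s : Finset ℤ} (hs : ∀ v ∈ s, -v ∈ s) {C : Finset (ℤ × ℤ)}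
    (hC : C ∈ halves s) : ∃ P : Finpartition s, IsSymm P ∧ arcs P = double C := by
  obtain ⟨P, hP⟩ := exists_arcs_eq (isArcSet_double hs hC)
  have h := (mem_halves.1 hC).2
  refine ⟨P, ⟨?_, ?_⟩, hP⟩
  · intro a ha
    rw [hP, mem_double] at *
    simpa [mirror, or_comm] using ha
  · intro a ha hne
    rw [hP, mem_double] at ha
    rcases ha with ha | ha
    · exact absurd hne.symm (by have := h.disj _ ha _ ha; omega)
    · exact absurd hne.symm (by have := h.disj _ ha _ ha; simp [mirror] at this; omega)

/-- Summing over symmetric partitions is the same as summing over halves of arc sets. -/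
lemma sum_isSymm {M : Type*} [AddCommMonoid M] {s : Finset ℤ} (hs : ∀ v ∈ s, -v ∈ s)
    (S : Finset (Finpartition s)) (T : Finset (Finset (ℤ × ℤ)))
    (hT : ∀ C ∈ T, C ∈ halves s)
    (hST : ∀ P, P ∈ S ↔ IsSymm P ∧ half (arcs P) ∈ T)
    (f : Finpartition s → M) (g : Finset (ℤ × ℤ) → M)
    (hfg : ∀ P, IsSymm P → f P = g (half (arcs P))) : ∑ P ∈ S, f P = ∑ C ∈ T, g C := by
  refine sum_nbij (fun P => half (arcs P)) (fun P hP => ((hST P).1 hP).2) ?_ ?_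
    fun P hP => hfg P ((hST P).1 hP).1
  · intro P hP Q hQ h
    have hP := ((hST P).1 hP).1
    have hQ := ((hST Q).1 hQ).1
    apply arcs_injective
    rw [← hP.double_half, ← hQ.double_half]
    exact congrArg double h
  · intro C hC
    obtain ⟨P, hP, h⟩ := exists_arcs_eq_double hs (hT C hC)
    have h1 : half (arcs P) = C := by
      rw [h, half_double (mem_halves.1 (hT C hC)).2.lt]
    exact ⟨P, (hST P).2 ⟨hP, by rwa [h1]⟩, h1⟩

lemma card_double {C : Finset (ℤ × ℤ)} (hC : ∀ c ∈ C, |c.1| < c.2) :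
    (double C).card = 2 * C.card := by
  rw [double, card_union_of_disjoint, card_image_of_injective _ mirror_injective, two_mul]
  rw [disjoint_left]
  intro a ha h
  rw [mem_image] at h
  obtain ⟨b, hb, rfl⟩ := h
  have h1 := hC _ ha
  have h2 := hC _ hb
  simp only [mirror, abs_neg] at h1
  grind

lemma filter_double (r : ℤ × ℤ → Prop) [DecidablePred r] (hr : ∀ a, r (mirror a) ↔ r a)
    (C : Finset (ℤ × ℤ)) : (double C).filter r = double (C.filter r) := by
  ext a
  simp only [mem_filter, mem_double, hr]
  tauto

lemma IsSymm.card_arcs {s : Finset ℤ} {P : Finpartition s} (hP : IsSymm P) :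
    (arcs P).card / 2 = (half (arcs P)).card := by
  conv_lhs => rw [← hP.double_half]
  rw [card_double fun c hc => (mem_half.1 hc).2]
  omega

/-- The mirror map preserves `j - i`, hence being a cover, so it doubles the covers and the
noncovers of the half separately. -/
lemma IsSymm.weight_eq {R : Type*} [CommRing R] {s : Finset ℤ} {P : Finpartition s}
    (hP : IsSymm P) (x y : R) :
    weight P x y = x ^ ((half (arcs P)).filter fun a => ¬ a.2 = a.1 + 1).card *
      y ^ ((half (arcs P)).filter fun a => a.2 = a.1 + 1).card := by
  have key : ∀ r : ℤ × ℤ → Prop, [DecidablePred r] → (∀ a, r (mirror a) ↔ r a) →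
      ((arcs P).filter r).card / 2 = ((half (arcs P)).filter r).card := by
    intro r _ hr
    conv_lhs => rw [← hP.double_half]
    rw [filter_double r hr, card_double fun c hc => (mem_half.1 (mem_filter.1 hc).1).2]
    omega
  have h1 : ∀ a : ℤ × ℤ, (mirror a).2 = (mirror a).1 + 1 ↔ a.2 = a.1 + 1 := by
    intro a
    simp only [mirror]
    omega
  rw [weight, cov, ← filter_not, key _ fun a => not_congr (h1 a), key _ h1]

/-- For `c`, `d` in the half with `c.2 < d.2`, the condition `c.1 < |d.1| < c.2` means that `c`
crosses `d` or the mirror image of `d`. The permitted crossing of an arc with its own mirror image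
is invisible in the half. -/
lemma IsSymm.isNC_iff {s : Finset ℤ} {P : Finpartition s} (hP : IsSymm P) :
    IsNC P ↔ HalfNC (half (arcs P)) := by
  constructor
  · intro h c hc d hd hlt
    rw [mem_half] at hc hd
    by_contra hcon
    push Not at hcon
    obtain ⟨h1, h2⟩ := hcon
    have h3 := h c hc.1 d hd.1
    have h4 := h _ (hP.1 d hd.1) c hc.1
    -- If `c.1 < d.1`, then `c` and `d` themselves cross. Otherwise `d.1` is negative and the mirror
    -- image of `d` crosses `c`.
    have h5 : d.1 ≤ c.1 := by
      by_contra h5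
      have := congrArg Prod.fst (h3 (by omega) (by grind) hlt)
      simp only at this
      grind
    have h6 : d.1 < 0 := by grind
    rw [abs_of_neg h6] at h1 h2
    have := congrArg Prod.fst (h4 (by simp only; grind) (by simpa using h2) (by simpa using h1))
    simp only at this
    grind
  · intro h a ha b hb h1 h2 h3
    have key : ∀ c ∈ arcs P, |c.1| < c.2 ∨ |c.2| < -c.1 := by
      intro c hc
      have := hP.2 c hc
      have := (isArcSet_arcs P).lt c hc
      grind
    have hm : ∀ c ∈ arcs P, |c.2| < -c.1 → mirror c ∈ half (arcs P) := fun c hc h =>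
      mem_half.2 ⟨hP.1 c hc, by simpa [mirror] using h⟩
    have hinj := (isArcSet_arcs P).inj_right
    rcases key a ha with ha' | ha' <;> rcases key b hb with hb' | hb'
    · have := h a (mem_half.2 ⟨ha, ha'⟩) b (mem_half.2 ⟨hb, hb'⟩) h3
      grind
    · grind
    -- Here `a` is a mirrored arc and `b` is in the half. Equality is the permitted case, where `a`
    -- is the mirror image of `b`.
    · rcases lt_trichotomy (-a.1) b.2 with h4 | h4 | h4
      · have := h _ (hm a ha ha') b (mem_half.2 ⟨hb, hb'⟩) (by simpa [mirror] using h4)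
        simp only [mirror] at this
        grind
      · exact hinj a ha _ (hP.1 b hb)
          (by
            have := (isArcSet_arcs P).inj_left a ha _ (hP.1 b hb) (by simp; omega)
            rw [this])
      · have := h b (mem_half.2 ⟨hb, hb'⟩) _ (hm a ha ha') (by simpa [mirror] using h4)
        simp only [mirror] at this
        grind
    · have := h _ (hm b hb hb') _ (hm a ha ha') (by simp [mirror]; omega)
      simp only [mirror] at this
      grind

/-! ### Turning covers into loops -/

/-- Like `Adm`, but allowing loops `(v, v)` with `v` positive. -/
structure WAdm (p : ℤ → Prop) (q : Prop) (C : Finset (ℤ × ℤ)) : Prop where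
  lt : ∀ c ∈ C, -c.2 < c.1
  le : ∀ c ∈ C, c.1 ≤ c.2
  src : ∀ c ∈ C, p c.1
  inj_left : ∀ c ∈ C, ∀ d ∈ C, c.1 = d.1 → c = d
  inj_right : ∀ c ∈ C, ∀ d ∈ C, c.2 = d.2 → c = d
  disj : ∀ c ∈ C, ∀ d ∈ C, c.2 ≠ -d.1
  nc : q → ∀ c ∈ C, ∀ d ∈ C, c.2 < d.2 → c.2 < |d.1| ∨ |d.1| < c.1

/-- The weakly admissible sets with targets in `{1, …, n}`. -/
noncomputable def weak (p : ℤ → Prop) (q : Prop) (n : ℕ) : Finset (Finset (ℤ × ℤ)) :=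
  open Classical in (Icc (-n : ℤ) n ×ˢ Icc (1 : ℤ) n).powerset.filter (WAdm p q)

lemma mem_weak {p : ℤ → Prop} {q : Prop} {n : ℕ} {C : Finset (ℤ × ℤ)} :
    C ∈ weak p q n ↔ (∀ c ∈ C, c.2 ≤ n) ∧ WAdm p q C := by
  simp only [weak, mem_filter, mem_powerset]
  refine and_congr_left fun h => ⟨fun hC c hc => ?_, fun hC c hc => ?_⟩
  · have := hC hc
    simp only [mem_product, mem_Icc] at this
    exact this.2.2
  · have h1 := hC c hc
    have h2 := h.lt c hc
    have h3 := h.le c hc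
    simp only [mem_product, mem_Icc]
    omega

/-- The weight enumerator of weakly admissible sets, where loops have weight `y`. -/
noncomputable def weakSum {R : Type*} [CommRing R] (p : ℤ → Prop) (q : Prop) (n : ℕ) (x y : R) :
    R :=
  ∑ C ∈ weak p q n, x ^ (C.filter fun a => ¬ a.2 = a.1).card * y ^ (C.filter fun a => a.2 = a.1).card

lemma image_eq_of_inj {α β : Type*} [DecidableEq β] {f : α → β} {C D : Finset α} {t : Set α}
    (hf : Set.InjOn f t) (hC : ∀ c ∈ C, c ∈ t) (hD : ∀ c ∈ D, c ∈ t)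
    (h : C.image f = D.image f) : C = D := by
  have aux : ∀ C D : Finset α, (∀ c ∈ C, c ∈ t) → (∀ c ∈ D, c ∈ t) → C.image f = D.image f →
      C ⊆ D := by
    intro C D hC hD h c hc
    have : f c ∈ D.image f := h ▸ mem_image_of_mem f hc
    obtain ⟨d, hd, hdc⟩ := mem_image.1 this
    rwa [← hf (hD d hd) (hC c hc) hdc]
  exact (aux C D hC hD h).antisymm (aux D C hD hC h.symm)

/-- Shifting arcs turns covers into loops. -/
lemma sum_shift {R : Type*} [CommRing R] (x y : R) {p : ℤ → Prop} {q : Prop} {n : ℕ}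
    (f : ℤ × ℤ → ℤ × ℤ) (t : Finset (ℤ × ℤ)) (hf : Set.InjOn f t)
    (hcov : ∀ a ∈ t, (f a).2 = (f a).1 ↔ a.2 = a.1 + 1)
    (T : Finset (Finset (ℤ × ℤ))) (hTt : ∀ C ∈ T, C ⊆ t)
    (hT : ∀ C ⊆ t, C ∈ T ↔ C.image f ∈ weak p q n)
    (hsurj : ∀ D ∈ weak p q n, ∀ d ∈ D, ∃ a ∈ t, f a = d) :
    ∑ C ∈ T, x ^ (C.filter fun a => ¬ a.2 = a.1 + 1).card *
      y ^ (C.filter fun a => a.2 = a.1 + 1).card = weakSum p q n x y := by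
  refine sum_nbij (fun C => C.image f) (fun C hC => (hT C (hTt C hC)).1 hC) ?_ ?_ ?_
  · intro C hC D hD h
    exact image_eq_of_inj hf (fun c hc => hTt C hC hc) (fun c hc => hTt D hD hc) h
  · intro D hD
    have h1 : (D : Set (ℤ × ℤ)) ⊆ f '' t := by
      intro d hd
      obtain ⟨a, ha, h⟩ := hsurj D hD d hd
      exact ⟨a, ha, h⟩
    obtain ⟨C, hC, hCD⟩ := subset_set_image_iff.1 h1
    have hC : C ⊆ t := by exact_mod_cast hC
    exact ⟨C, (hT C hC).2 (hCD ▸ hD), hCD⟩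
  · intro C hC
    have hCt := hTt C hC
    have key : ∀ r s : ℤ × ℤ → Prop, [DecidablePred r] → [DecidablePred s] →
        (∀ a ∈ t, s (f a) ↔ r a) → (C.filter r).card = ((C.image f).filter s).card := by
      intro r s _ _ h
      rw [filter_image, card_image_of_injOn]
      · exact congrArg card (filter_congr fun a ha => (h a (hCt ha)).symm)
      · exact hf.mono fun a ha => hCt (mem_filter.1 ha).1
    rw [key _ (fun a => ¬ a.2 = a.1) fun a ha => not_congr (hcov a ha),
      key _ (fun a => a.2 = a.1) hcov]

lemma groundB_neg {n : ℕ} : ∀ v ∈ groundB n, -v ∈ groundB n := by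
  intro v hv
  simp only [groundB, mem_Icc] at *
  omega

lemma groundD_neg {n : ℕ} : ∀ v ∈ groundD n, -v ∈ groundD n := by
  intro v hv
  simp only [groundD, groundB, mem_erase, mem_Icc] at *
  omega

/-- The halves of noncrossing symmetric arc sets, or of all of them. -/
noncomputable def ncHalves (q : Prop) (s : Finset ℤ) : Finset (Finset (ℤ × ℤ)) :=
  open Classical in (halves s).filter fun C => q → HalfNC C

lemma mem_ncHalves {q : Prop} {s : Finset ℤ} {C : Finset (ℤ × ℤ)} :
    C ∈ ncHalves q s ↔ C ∈ halves s ∧ (q → HalfNC C) := by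
  simp [ncHalves]

/-- A cover in the half has a nonnegative source, so raising nonnegative sources by 1 makes it a
loop and leaves 0 unused as a source. The weak inequalities of `HalfNC` become strict because
`inj_left` and `disj` exclude the coincidences. -/
lemma sum_ncHalves_groundB {R : Type*} [CommRing R] (x y : R) (q : Prop) (n : ℕ) :
    ∑ C ∈ ncHalves q (groundB n), x ^ (C.filter fun a => ¬ a.2 = a.1 + 1).card *
      y ^ (C.filter fun a => a.2 = a.1 + 1).card = weakSum (fun i => i ≠ 0) q n x y := by
  have hmt : ∀ a : ℤ × ℤ, a ∈ ((groundB n ×ˢ groundB n).filter fun a => |a.1| < a.2) ↔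
      a.2 ≤ n ∧ |a.1| < a.2 := by
    intro a
    simp only [mem_filter, mem_product, groundB, mem_Icc]
    grind
  refine sum_shift x y (fun a => (if 0 ≤ a.1 then a.1 + 1 else a.1, a.2))
    ((groundB n ×ˢ groundB n).filter fun a => |a.1| < a.2) ?_ ?_ _ ?_ ?_ ?_
  · rintro ⟨a, b⟩ - ⟨c, d⟩ - h
    grind
  · rintro ⟨a, b⟩ h
    rw [hmt] at h
    grind
  · intro C hC
    rw [mem_ncHalves, mem_halves] at hC
    intro c hc
    exact mem_filter.2 ⟨hC.1.1 hc, hC.1.2.lt c hc⟩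
  · intro C hC
    have hC' : ∀ c ∈ C, c.2 ≤ n ∧ |c.1| < c.2 := fun c hc => (hmt c).1 (hC hc)
    have hC2 : C ⊆ groundB n ×ˢ groundB n := fun c hc => (mem_filter.1 (hC hc)).1
    rw [mem_ncHalves, mem_halves, mem_weak]
    constructor
    · rintro ⟨⟨-, h⟩, hq⟩
      refine ⟨?_, ?_, ?_, ?_, ?_, ?_, ?_, ?_⟩ <;> simp only [forall_mem_image]
      · exact fun c hc => (hC' c hc).1
      · intro c hc; have := hC' c hc; grind
      · intro c hc; have := hC' c hc; grind
      · intro c hc; have := hC' c hc; grind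
      · intro c hc d hd hcd
        have := h.inj_left c hc d hd (by grind)
        grind
      · intro c hc d hd hcd
        have := h.inj_right c hc d hd hcd
        grind
      · intro c hc d hd
        have := h.disj c hc d hd
        have := hC' c hc
        grind
      · intro hq' c hc d hd hlt
        have h1 := hq hq' c hc d hd hlt
        have h2 := h.disj c hc d hd
        have h3 := h.inj_left c hc d hd
        have := hC' c hc
        have := hC' d hd
        grind
    · rintro ⟨-, h⟩
      have h1 := h.inj_left
      have h2 := h.inj_right
      have h3 := h.disj
      have h4 := h.nc
      simp only [forall_mem_image] at h1 h2 h3 h4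
      refine ⟨⟨hC2, fun c hc => (hC' c hc).2, fun _ _ => trivial, ?_, ?_, ?_, False.elim⟩, ?_⟩
      · intro c hc d hd hcd
        have := h1 hc hd (by grind)
        ext <;> grind
      · intro c hc d hd hcd
        have := h2 hc hd hcd
        ext <;> grind
      · intro c hc d hd hcd
        have := h3 hc hd
        have := hC' c hc
        grind
      · intro hq c hc d hd hlt
        have := h4 hq hc hd hlt
        have := hC' c hc
        have := hC' d hd
        grind
  · intro D hD d hd
    rw [mem_weak] at hD
    have h1 := hD.1 d hd
    have h2 := hD.2.lt d hd
    have h3 := hD.2.le d hd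
    have h4 := hD.2.src d hd
    refine ⟨(if 0 < d.1 then d.1 - 1 else d.1, d.2), (hmt _).2 ?_, ?_⟩
    · grind
    · ext <;> grind

/-- Raising negative sources and lowering all targets by 1 makes covers into loops. The source -1
moves to 0, so no source is excluded; the target 1 never occurs in the half, so the targets become
`1, …, n`. -/
lemma sum_ncHalves_groundD {R : Type*} [CommRing R] (x y : R) (q : Prop) (n : ℕ) :
    ∑ C ∈ ncHalves q (groundD (n + 1)), x ^ (C.filter fun a => ¬ a.2 = a.1 + 1).card *
      y ^ (C.filter fun a => a.2 = a.1 + 1).card = weakSum (fun _ => True) q n x y := by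
  have hmt : ∀ a : ℤ × ℤ, a ∈ ((groundD (n + 1) ×ˢ groundD (n + 1)).filter fun a => |a.1| < a.2) ↔
      a.1 ≠ 0 ∧ a.2 ≤ n + 1 ∧ |a.1| < a.2 := by
    intro a
    simp only [mem_filter, mem_product, groundD, mem_erase, groundB, mem_Icc]
    grind
  refine sum_shift x y (fun a => (if 0 < a.1 then a.1 else a.1 + 1, a.2 - 1))
    ((groundD (n + 1) ×ˢ groundD (n + 1)).filter fun a => |a.1| < a.2) ?_ ?_ _ ?_ ?_ ?_
  · rintro ⟨a, b⟩ h1 ⟨c, d⟩ h2 h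
    rw [mem_coe, hmt] at h1 h2
    grind
  · rintro ⟨a, b⟩ h
    rw [hmt] at h
    grind
  · intro C hC
    rw [mem_ncHalves, mem_halves] at hC
    intro c hc
    exact mem_filter.2 ⟨hC.1.1 hc, hC.1.2.lt c hc⟩
  · intro C hC
    have hC' : ∀ c ∈ C, c.1 ≠ 0 ∧ c.2 ≤ n + 1 ∧ |c.1| < c.2 := fun c hc => (hmt c).1 (hC hc)
    have hC2 : C ⊆ groundD (n + 1) ×ˢ groundD (n + 1) := fun c hc => (mem_filter.1 (hC hc)).1
    rw [mem_ncHalves, mem_halves, mem_weak]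
    constructor
    · rintro ⟨⟨-, h⟩, hq⟩
      refine ⟨?_, ?_, ?_, ?_, ?_, ?_, ?_, ?_⟩ <;> simp only [forall_mem_image]
      · intro c hc; have := hC' c hc; omega
      · intro c hc; have := hC' c hc; grind
      · intro c hc; have := hC' c hc; grind
      · intro c hc; trivial
      · intro c hc d hd hcd
        have := hC' c hc
        have := hC' d hd
        have := h.inj_left c hc d hd (by grind)
        grind
      · intro c hc d hd hcd
        have := h.inj_right c hc d hd (by omega)
        grind
      · intro c hc d hd
        have := h.disj c hc d hd
        have := hC' c hc
        grind
      · intro hq' c hc d hd hlt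
        have h1 := hq hq' c hc d hd (by omega)
        have h2 := h.disj c hc d hd
        have h3 := h.inj_left c hc d hd
        have := hC' c hc
        have := hC' d hd
        grind
    · rintro ⟨-, h⟩
      have h1 := h.inj_left
      have h2 := h.inj_right
      have h3 := h.disj
      have h4 := h.nc
      simp only [forall_mem_image] at h1 h2 h3 h4
      refine ⟨⟨hC2, fun c hc => (hC' c hc).2.2, fun _ _ => trivial, ?_, ?_, ?_, False.elim⟩, ?_⟩
      · intro c hc d hd hcd
        have := h1 hc hd (by grind)
        ext <;> grind
      · intro c hc d hd hcd
        have := h2 hc hd (by omega)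
        ext <;> grind
      · intro c hc d hd hcd
        have := h3 hc hd
        have := hC' c hc
        grind
      · intro hq c hc d hd hlt
        have := h4 hq hc hd (by omega)
        have := hC' c hc
        have := hC' d hd
        grind
  · intro D hD d hd
    rw [mem_weak] at hD
    have h1 := hD.1 d hd
    have h2 := hD.2.lt d hd
    have h3 := hD.2.le d hd
    refine ⟨(if 0 < d.1 then d.1 else d.1 - 1, d.2 + 1), (hmt _).2 ?_, ?_⟩
    · grind
    · ext <;> grind

lemma BellB_eq {R : Type*} [CommRing R] (n : ℕ) (x y : R) :
    BellB n x y = weakSum (fun i => i ≠ 0) False n x y := by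
  rw [← sum_ncHalves_groundB, BellB]
  refine sum_isSymm groundB_neg _ _ (fun C hC => (mem_ncHalves.1 hC).1) ?_ _ _
    fun P hP => hP.weight_eq x y
  intro P
  simp only [PiB, mem_filter, mem_univ, true_and, mem_ncHalves]
  exact ⟨fun h => ⟨h, h.half_mem, False.elim⟩, fun h => h.1⟩

lemma BellD_eq {R : Type*} [CommRing R] (n : ℕ) (x y : R) :
    BellD (n + 1) x y = weakSum (fun _ => True) False n x y := by
  rw [← sum_ncHalves_groundD, BellD]
  refine sum_isSymm groundD_neg _ _ (fun C hC => (mem_ncHalves.1 hC).1) ?_ _ _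
    fun P hP => hP.weight_eq x y
  intro P
  simp only [PiD, mem_filter, mem_univ, true_and, mem_ncHalves]
  exact ⟨fun h => ⟨h, h.half_mem, False.elim⟩, fun h => h.1⟩

lemma CatB_eq {R : Type*} [CommRing R] (n : ℕ) (x y : R) :
    CatB n x y = weakSum (fun i => i ≠ 0) True n x y := by
  rw [← sum_ncHalves_groundB, CatB]
  refine sum_isSymm groundB_neg _ _ (fun C hC => (mem_ncHalves.1 hC).1) ?_ _ _
    fun P hP => hP.weight_eq x y
  intro P
  simp only [NCB, PiB, mem_filter, mem_univ, true_and, mem_ncHalves]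
  exact ⟨fun h => ⟨h.1, h.1.half_mem, fun _ => h.1.isNC_iff.1 h.2⟩,
    fun h => ⟨h.1, h.1.isNC_iff.2 (h.2.2 trivial)⟩⟩

lemma CatD_eq {R : Type*} [CommRing R] (n : ℕ) (x y : R) :
    CatD (n + 1) x y = weakSum (fun _ => True) True n x y := by
  rw [← sum_ncHalves_groundD, CatD]
  refine sum_isSymm groundD_neg _ _ (fun C hC => (mem_ncHalves.1 hC).1) ?_ _ _
    fun P hP => hP.weight_eq x y
  intro P
  simp only [NCD, PiD, mem_filter, mem_univ, true_and, mem_ncHalves]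
  exact ⟨fun h => ⟨h.1, h.1.half_mem, fun _ => h.1.isNC_iff.1 h.2⟩,
    fun h => ⟨h.1, h.1.isNC_iff.2 (h.2.2 trivial)⟩⟩

/-! ### Splitting off the loops -/

/-- The absolute values of the nonzero end points of a set of arcs. -/
def supp (C : Finset (ℤ × ℤ)) : Finset ℤ :=
  (C.image (fun c => |c.1|) ∪ C.image fun c => c.2).erase 0

lemma mem_supp {C : Finset (ℤ × ℤ)} {v : ℤ} :
    v ∈ supp C ↔ v ≠ 0 ∧ ∃ c ∈ C, |c.1| = v ∨ c.2 = v := by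
  simp only [supp, mem_erase, mem_union, mem_image]
  grind

/-- The admissible sets with given support. -/
noncomputable def adm (p : ℤ → Prop) (q : Prop) (T : Finset ℤ) : Finset (Finset (ℤ × ℤ)) :=
  open Classical in
  ((insert 0 (T ∪ T.image Neg.neg)) ×ˢ T).powerset.filter fun C => Adm p q C ∧ supp C = T

lemma mem_adm {p : ℤ → Prop} {q : Prop} {T : Finset ℤ} {C : Finset (ℤ × ℤ)} :
    C ∈ adm p q T ↔ Adm p q C ∧ supp C = T := by
  simp only [adm, mem_filter, mem_powerset, and_iff_right_iff_imp, and_imp]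
  rintro h rfl c hc
  have h1 := h.lt c hc
  simp only [mem_product, mem_insert, mem_union, mem_image, mem_supp]
  refine ⟨?_, by grind, c, hc, .inr rfl⟩
  rcases lt_trichotomy c.1 0 with h2 | h2 | h2
  · exact .inr (.inr ⟨-c.1, ⟨by omega, c, hc, .inl (abs_of_neg h2)⟩, by simp⟩)
  · exact .inl h2
  · exact .inr (.inl ⟨by omega, c, hc, .inl (abs_of_pos h2)⟩)

/-- The weight enumerator of the admissible sets with given support. -/
noncomputable def admSum {R : Type*} [CommRing R] (p : ℤ → Prop) (q : Prop) (T : Finset ℤ)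
    (x : R) : R :=
  ∑ C ∈ adm p q T, x ^ C.card

lemma Adm.supp_pos {p : ℤ → Prop} {q : Prop} {C : Finset (ℤ × ℤ)} (hC : Adm p q C) {v : ℤ}
    (hv : v ∈ supp C) : 0 < v := by
  obtain ⟨h0, c, hc, h⟩ := mem_supp.1 hv
  have := hC.lt c hc
  grind

/-- The loops can be placed at an arbitrary subset of `[n] \ T`, independently of the other arcs. -/
lemma sum_weak_fiber {R : Type*} [CommRing R] {p : ℤ → Prop} (hp : ∀ v, 0 < v → p v) (q : Prop)
    (n : ℕ) (x y : R) {T : Finset ℤ} (hT : T ⊆ Icc (1 : ℤ) n) :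
    ∑ C ∈ weak p q n with supp (C.filter fun a => ¬ a.2 = a.1) = T,
      x ^ (C.filter fun a => ¬ a.2 = a.1).card * y ^ (C.filter fun a => a.2 = a.1).card =
    (y + 1) ^ (n - T.card) * admSum p q T x := by
  have hcard : n - T.card = (Icc (1 : ℤ) n \ T).card := by
    rw [card_sdiff_of_subset hT]
    simp
  -- The power of `y + 1` is expanded as a sum over the sets `L` of loop positions, which makes the
  -- right side a sum over pairs `(L, D)`.
  rw [hcard, ← sum_pow_mul_eq_add_pow, admSum, sum_mul_sum, ← sum_product']
  have hdiag : Function.Injective fun v : ℤ => (v, v) := fun a b h => by simpa using h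
  have hfil1 : ∀ D : Finset (ℤ × ℤ), ∀ L : Finset ℤ, (∀ d ∈ D, |d.1| < d.2) →
      (D ∪ L.image fun v => (v, v)).filter (fun a => ¬ a.2 = a.1) = D := by
    intro D L hD
    ext a
    simp only [mem_filter, mem_union, mem_image]
    have := hD a
    grind
  have hfil2 : ∀ D : Finset (ℤ × ℤ), ∀ L : Finset ℤ, (∀ d ∈ D, |d.1| < d.2) →
      (D ∪ L.image fun v => (v, v)).filter (fun a => a.2 = a.1) = L.image fun v => (v, v) := by
    intro D L hD
    ext a
    simp only [mem_filter, mem_union, mem_image]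
    have := hD a
    grind
  have himg : ∀ C : Finset (ℤ × ℤ), (((C.filter fun a => a.2 = a.1).image Prod.fst).image
      fun v => (v, v)) = C.filter fun a => a.2 = a.1 := by
    intro C
    ext a
    simp only [mem_filter, mem_image]
    grind
  refine sum_nbij' (fun C => ((C.filter fun a => a.2 = a.1).image Prod.fst,
      C.filter fun a => ¬ a.2 = a.1)) (fun z => z.2 ∪ z.1.image fun v => (v, v)) ?_ ?_ ?_ ?_ ?_
  · intro C hC
    obtain ⟨hC, hs⟩ := mem_filter.1 hC
    rw [mem_weak] at hC
    obtain ⟨hn, hC⟩ := hC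
    refine mem_product.2 ⟨?_, mem_adm.2 ⟨?_, hs⟩⟩
    · rw [mem_powerset]
      intro v hv
      obtain ⟨c, hc, rfl⟩ := mem_image.1 hv
      obtain ⟨hc, hc2⟩ := mem_filter.1 hc
      have := hC.lt c hc
      have := hn c hc
      rw [mem_sdiff, mem_Icc]
      refine ⟨by omega, ?_⟩
      rw [← hs, mem_supp]
      rintro ⟨-, d, hd, h⟩
      obtain ⟨hd, hd2⟩ := mem_filter.1 hd
      have h1 := hC.inj_left d hd c hc
      have h2 := hC.inj_right d hd c hc
      have h3 := hC.disj c hc d hd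
      grind
    · refine ⟨?_, fun c hc => hC.src c (mem_filter.1 hc).1,
        fun c hc d hd => hC.inj_left c (mem_filter.1 hc).1 d (mem_filter.1 hd).1,
        fun c hc d hd => hC.inj_right c (mem_filter.1 hc).1 d (mem_filter.1 hd).1,
        fun c hc d hd => hC.disj c (mem_filter.1 hc).1 d (mem_filter.1 hd).1,
        fun hq c hc d hd => hC.nc hq c (mem_filter.1 hc).1 d (mem_filter.1 hd).1⟩
      intro c hc
      obtain ⟨hc, hc2⟩ := mem_filter.1 hc
      have := hC.lt c hc
      have := hC.le c hc
      grind
  · rintro ⟨L, D⟩ h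
    rw [mem_product, mem_powerset, mem_adm] at h
    obtain ⟨hL, hD, hs⟩ := h
    simp only at hL hD hs
    rw [mem_filter, mem_weak, hfil1 D L hD.lt]
    have hmem : ∀ c ∈ D ∪ L.image (fun v => (v, v)), c ∈ D ∧ |c.1| < c.2 ∨
        c.1 = c.2 ∧ c.1 ∈ Icc (1 : ℤ) n ∧ c.1 ∉ supp D := by
      intro c hc
      rcases mem_union.1 hc with hc | hc
      · exact .inl ⟨hc, hD.lt c hc⟩
      · obtain ⟨v, hv, rfl⟩ := mem_image.1 hc
        have := mem_sdiff.1 (hL hv)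
        exact .inr ⟨rfl, this.1, hs ▸ this.2⟩
    have hns : ∀ v, v ∈ Icc (1 : ℤ) n ∧ v ∉ supp D → 0 < v ∧ v ≤ n ∧
        ∀ c ∈ D, c.1 ≠ v ∧ c.1 ≠ -v ∧ c.2 ≠ v := by
      rintro v ⟨h1, h2⟩
      rw [mem_Icc] at h1
      refine ⟨by omega, by omega, fun c hc => ?_⟩
      simp only [mem_supp, not_and, not_exists, not_or] at h2
      have := h2 (by omega) c hc
      grind
    have hrange : ∀ c ∈ D, c.2 ≤ n := by
      intro c hc
      have : c.2 ∈ supp D := mem_supp.2 ⟨by have := hD.lt c hc; grind, c, hc, .inr rfl⟩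
      exact (mem_Icc.1 (hT (hs ▸ this))).2
    refine ⟨⟨?_, ?_, ?_, ?_, ?_, ?_, ?_, ?_⟩, hs⟩
    · intro c hc
      rcases hmem c hc with h | h
      · exact hrange c h.1
      · have := hns _ h.2
        grind
    · intro c hc
      rcases hmem c hc with h | h
      · grind
      · have := hns _ h.2
        grind
    · intro c hc
      rcases hmem c hc with h | h <;> grind
    · intro c hc
      rcases hmem c hc with h | h
      · exact hD.src c h.1
      · exact hp _ (hns _ h.2).1
    · intro c hc d hd hcd
      rcases hmem c hc with h | h <;> rcases hmem d hd with h' | h'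
      · exact hD.inj_left c h.1 d h'.1 hcd
      · have := (hns _ h'.2).2.2 c h.1
        grind
      · have := (hns _ h.2).2.2 d h'.1
        grind
      · ext <;> grind
    · intro c hc d hd hcd
      rcases hmem c hc with h | h <;> rcases hmem d hd with h' | h'
      · exact hD.inj_right c h.1 d h'.1 hcd
      · have := (hns _ h'.2).2.2 c h.1
        grind
      · have := (hns _ h.2).2.2 d h'.1
        grind
      · ext <;> grind
    · intro c hc d hd hcd
      rcases hmem c hc with h | h <;> rcases hmem d hd with h' | h'
      · exact hD.disj c h.1 d h'.1 hcd
      · have := hns _ h'.2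
        grind
      · have := (hns _ h.2).2.2 d h'.1
        grind
      · have := hns _ h.2
        have := hns _ h'.2
        grind
    · intro hq c hc d hd hlt
      rcases hmem c hc with h | h <;> rcases hmem d hd with h' | h'
      · exact hD.nc hq c h.1 d h'.1 hlt
      · have := hns _ h'.2
        grind
      · have := (hns _ h.2)
        have := this.2.2 d h'.1
        grind
      · have := hns _ h.2
        have := hns _ h'.2
        grind
  · intro C hC
    simp only [himg]
    ext a
    simp only [mem_union, mem_filter]
    tauto
  · rintro ⟨L, D⟩ h
    rw [mem_product, mem_adm] at h
    have hD := h.2.1.lt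
    simp only [hfil1 D L hD, hfil2 D L hD, Prod.mk.injEq, and_true]
    rw [image_image]
    exact image_id
  · intro C hC
    have : ((C.filter fun a => a.2 = a.1).image Prod.fst).card =
        (C.filter fun a => a.2 = a.1).card := by
      conv_rhs => rw [← himg, card_image_of_injective _ hdiag]
    simp only [this, one_pow, mul_one]
    ring

lemma weakSum_eq_sum_powerset {R : Type*} [CommRing R] {p : ℤ → Prop} (hp : ∀ v, 0 < v → p v)
    (q : Prop) (n : ℕ) (x y : R) :
    weakSum p q n x y =
      ∑ T ∈ (Icc (1 : ℤ) n).powerset, (y + 1) ^ (n - T.card) * admSum p q T x := by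
  rw [weakSum, ← sum_fiberwise_of_maps_to (t := (Icc (1 : ℤ) n).powerset)
    (g := fun C => supp (C.filter fun a => ¬ a.2 = a.1))]
  · exact sum_congr rfl fun T hT => sum_weak_fiber hp q n x y (mem_powerset.1 hT)
  · intro C hC
    rw [mem_weak] at hC
    rw [mem_powerset]
    intro v hv
    obtain ⟨h0, c, hc, h⟩ := mem_supp.1 hv
    have hc := (mem_filter.1 hc).1
    have := hC.1 c hc
    have := hC.2.lt c hc
    have := hC.2.le c hc
    rw [mem_Icc]
    grind

/-! ### Dependence on the size of the support only -/

/-- A strictly increasing odd map identifies the admissible sets on a set and on its image. -/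
lemma admSum_image {R : Type*} [CommRing R] {p : ℤ → Prop} (q : Prop) {g : ℤ → ℤ}
    (hg : StrictMono g) (hodd : ∀ i, g (-i) = -g i) (hp : ∀ i, p (g i) ↔ p i) (T : Finset ℤ)
    (x : R) : admSum p q (T.image g) x = admSum p q T x := by
  have h0 : g 0 = 0 := by have := hodd 0; simp at this; omega
  have habs : ∀ i, |g i| = g |i| := by
    intro i
    rcases le_total 0 i with h | h
    · rw [abs_of_nonneg h, abs_of_nonneg (h0 ▸ hg.monotone h)]
    · rw [abs_of_nonpos h, abs_of_nonpos (h0 ▸ hg.monotone h), hodd]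
  have hinj : Function.Injective (Prod.map g g) := hg.injective.prodMap hg.injective
  have hadm : ∀ C : Finset (ℤ × ℤ), Adm p q (C.image (Prod.map g g)) ↔ Adm p q C := by
    intro C
    constructor <;> intro h <;> obtain ⟨h1, h2, h3, h4, h5, h6⟩ := h <;> constructor <;>
      simp only [forall_mem_image, Prod.map_fst, Prod.map_snd, habs, ← hodd, hg.lt_iff_lt, hp,
        hg.injective.eq_iff, hinj.eq_iff, ne_eq] at * <;> assumption
  have hsupp : ∀ C : Finset (ℤ × ℤ), supp (C.image (Prod.map g g)) = (supp C).image g := by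
    intro C
    ext v
    simp only [mem_supp, mem_image, exists_exists_and_eq_and, Prod.map_fst, Prod.map_snd, habs]
    constructor
    · rintro ⟨hv, c, hc, rfl | rfl⟩
      · exact ⟨_, ⟨fun h => hv (by rw [h, h0]), c, hc, .inl rfl⟩, rfl⟩
      · exact ⟨_, ⟨fun h => hv (by rw [h, h0]), c, hc, .inr rfl⟩, rfl⟩
    · rintro ⟨w, ⟨hw, c, hc, rfl | rfl⟩, rfl⟩
      · exact ⟨fun h => hw (hg.injective (h.trans h0.symm)), c, hc, .inl rfl⟩
      · exact ⟨fun h => hw (hg.injective (h.trans h0.symm)), c, hc, .inr rfl⟩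
  symm
  refine sum_nbij (fun C => C.image (Prod.map g g)) ?_ (image_injective hinj).injOn ?_ ?_
  · intro C hC
    rw [mem_adm] at *
    rw [hadm, hsupp, hC.2]
    exact ⟨hC.1, rfl⟩
  · intro D hD
    rw [mem_coe, mem_adm] at hD
    have hr : ∀ v ∈ supp D, ∃ i, g i = v := by
      intro v hv
      rw [hD.2] at hv
      obtain ⟨i, -, h⟩ := mem_image.1 hv
      exact ⟨i, h⟩
    have h1 : (D : Set (ℤ × ℤ)) ⊆ Prod.map g g '' Set.univ := by
      intro d hd
      have hlt := hD.1.lt d hd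
      obtain ⟨j, hj⟩ := hr d.2 (mem_supp.2 ⟨by grind, d, hd, .inr rfl⟩)
      obtain ⟨i, hi⟩ : ∃ i, g i = d.1 := by
        rcases lt_trichotomy d.1 0 with h | h | h
        · obtain ⟨i, hi⟩ := hr (-d.1) (mem_supp.2 ⟨by omega, d, hd, .inl (abs_of_neg h)⟩)
          exact ⟨-i, by rw [hodd, hi, neg_neg]⟩
        · exact ⟨0, by rw [h0, h]⟩
        · exact hr _ (mem_supp.2 ⟨by omega, d, hd, .inl (abs_of_pos h)⟩)
      exact ⟨(i, j), trivial, by ext <;> simp [hi, hj]⟩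
    obtain ⟨C, -, rfl⟩ := subset_set_image_iff.1 h1
    refine ⟨C, ?_, rfl⟩
    rw [mem_coe, mem_adm]
    rw [hadm, hsupp] at hD
    exact ⟨hD.1, image_injective hg.injective hD.2⟩
  · intro C hC
    rw [card_image_of_injective _ hinj]

/-- Every finite set of positive integers is the image of an initial segment under a strictly
increasing odd map. -/
lemma exists_odd_strictMono (T : Finset ℤ) (hT : ∀ v ∈ T, 0 < v) :
    ∃ g : ℤ → ℤ, StrictMono g ∧ (∀ i, g (-i) = -g i) ∧ (Icc (1 : ℤ) T.card).image g = T := by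
  obtain ⟨e, he, him⟩ : ∃ e : ℕ → ℤ, StrictMono e ∧ (range T.card).image e = T ∧ ∀ i, 0 < e i := by
    induction T using Finset.induction_on_max with
    | empty => exact ⟨fun i => i + 1, fun a b h => by simpa using h, by simp, fun i => by positivity⟩
    | insert a S hmax ih =>
      obtain ⟨e, he, him, hpos⟩ := ih fun v hv => hT v (mem_insert_of_mem hv)
      have ha : a ∉ S := fun h => lt_irrefl _ (hmax a h)
      have hlt : ∀ i < S.card, e i < a := fun i hi =>
        hmax _ (him ▸ mem_image_of_mem e (mem_range.2 hi))
      have ha0 := hT a (mem_insert_self a S)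
      -- Only the first `S.card + 1` values matter; beyond them the sequence continues by steps of 1
      -- to stay strictly increasing.
      refine ⟨fun i => if i < S.card then e i else a + (i - S.card : ℕ), ?_, ?_, ?_⟩
      · intro i j hij
        have h1 := he hij
        have h2 := hlt i
        dsimp only
        split_ifs
        · exact h1
        · have := h2 ‹_›
          omega
        · omega
        · omega
      · rw [card_insert_of_notMem ha, range_add_one, image_insert]
        have h1 : (range S.card).image (fun i => if i < S.card then e i else a + (i - S.card : ℕ)) =
            S := by
          conv_rhs => rw [← him]
          exact image_congr fun i hi => if_pos (mem_range.1 hi)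
        rw [h1]
        simp
      · intro i
        have := hpos i
        dsimp only
        split_ifs <;> omega
  obtain ⟨him, hpos⟩ := him
  refine ⟨fun i => if 0 < i then e (i - 1).toNat else if i = 0 then 0 else -e (-i - 1).toNat,
    ?_, ?_, ?_⟩
  · intro i j hij
    dsimp only
    have hp1 := hpos (i - 1).toNat
    have hp2 := hpos (j - 1).toNat
    have hp3 := hpos (-i - 1).toNat
    have hp4 := hpos (-j - 1).toNat
    split_ifs
    · exact he (by omega)
    any_goals omega
    exact neg_lt_neg (he (by omega))
  · intro i
    dsimp only
    rcases lt_trichotomy i 0 with h | rfl | h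
    · rw [if_pos (by omega), if_neg (by omega), if_neg (by omega), neg_neg]
    · simp
    · rw [if_neg (by omega), if_neg (by omega), if_pos h, neg_neg]
  · conv_rhs => rw [← him]
    ext v
    simp only [mem_image, mem_Icc, mem_range]
    constructor
    · rintro ⟨i, hi, rfl⟩
      exact ⟨(i - 1).toNat, by omega, by rw [if_pos (by omega)]⟩
    · rintro ⟨i, hi, rfl⟩
      exact ⟨i + 1, by omega, by rw [if_pos (by omega)]; simp⟩

/-- A condition on integers which depends only on the sign. -/
def SignInvariant (p : ℤ → Prop) : Prop :=
  ∀ g : ℤ → ℤ, StrictMono g → (∀ i, g (-i) = -g i) → ∀ i, p (g i) ↔ p i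

lemma signInvariant_pos : SignInvariant fun i => 0 < i := by
  intro g hg hodd i
  have h0 : g 0 = 0 := by have := hodd 0; simp at this; omega
  conv_lhs => rw [← h0]
  exact hg.lt_iff_lt

lemma signInvariant_ne : SignInvariant fun i => i ≠ 0 := by
  intro g hg hodd i
  have h0 : g 0 = 0 := by have := hodd 0; simp at this; omega
  conv_lhs => rw [← h0]
  exact hg.injective.ne_iff

lemma signInvariant_true : SignInvariant fun _ => True := fun _ _ _ _ => Iff.rfl

lemma admSum_eq_card {R : Type*} [CommRing R] {p : ℤ → Prop} (hp : SignInvariant p) (q : Prop)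
    {T : Finset ℤ} (hT : ∀ v ∈ T, 0 < v) (x : R) :
    admSum p q T x = admSum p q (Icc (1 : ℤ) T.card) x := by
  obtain ⟨g, hg, hodd, him⟩ := exists_odd_strictMono T hT
  conv_lhs => rw [← him]
  exact admSum_image q hg hodd (hp g hg hodd) _ x

lemma weakSum_eq {R : Type*} [CommRing R] {p : ℤ → Prop} (hp : SignInvariant p)
    (hp' : ∀ v, 0 < v → p v) (q : Prop) (n : ℕ) (x y : R) :
    weakSum p q n x y = ∑ k ∈ range (n + 1),
      (n.choose k : R) * ((y + 1) ^ (n - k) * admSum p q (Icc (1 : ℤ) k) x) := by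
  rw [weakSum_eq_sum_powerset hp']
  trans ∑ T ∈ (Icc (1 : ℤ) n).powerset,
    (fun k : ℕ => (y + 1) ^ (n - k) * admSum p q (Icc (1 : ℤ) k) x) T.card
  · refine sum_congr rfl fun T hT => ?_
    dsimp only
    rw [← admSum_eq_card hp]
    intro v hv
    have := mem_Icc.1 (mem_powerset.1 hT hv)
    omega
  · generalize hF : (fun k : ℕ => (y + 1) ^ (n - k) * admSum p q (Icc (1 : ℤ) k) x) = F
    rw [sum_powerset_apply_card, ← hF]
    simp [nsmul_eq_mul]

/-! ### Binomial inversion -/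

/-- Inversion of the binomial transform. -/
lemma binomial_inversion {R : Type*} [CommRing R] (z : R) (f g : ℕ → R)
    (h : ∀ n, f n = ∑ k ∈ range (n + 1), (n.choose k : R) * (z ^ (n - k) * g k)) (n : ℕ) :
    ∑ k ∈ range (n + 1), (-1 : R) ^ (n - k) * (n.choose k : R) * z ^ (n - k) * f k = g n := by
  -- The umbral functional `X ^ k ↦ g k`: the hypothesis says `f k = φ ((X + z) ^ k)`, and the claim
  -- is the expansion of `((X + z) - z) ^ n` under `φ`.
  let φ : Polynomial R →ₗ[R] R := Polynomial.lsum fun k => LinearMap.mulRight R (g k)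
  have hφ : ∀ (c : R) k, φ (Polynomial.C c * Polynomial.X ^ k) = c * g k := by
    intro c k
    rw [Polynomial.C_mul_X_pow_eq_monomial]
    simp [φ, Polynomial.lsum_apply, Polynomial.sum_monomial_index]
  have hf : ∀ k, φ ((Polynomial.X + Polynomial.C z) ^ k) = f k := by
    intro k
    rw [add_pow, map_sum, h]
    refine sum_congr rfl fun j _ => ?_
    rw [← mul_assoc, ← hφ]
    congr 1
    simp only [map_mul, map_pow, map_natCast]
    ring
  have h1 : φ ((Polynomial.X + Polynomial.C z + Polynomial.C (-z)) ^ n) = g n := by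
    have := hφ 1 n
    simpa using this
  rw [← h1, add_pow, map_sum]
  refine sum_congr rfl fun k _ => ?_
  rw [← hf, ← smul_eq_mul, ← map_smul]
  congr 1
  rw [Polynomial.smul_eq_C_mul]
  simp only [map_mul, map_pow, map_natCast, map_neg, map_one]
  rw [neg_pow (Polynomial.C z)]
  ring

/-- The binomial transforms of the theorem single out the sets with full support. -/
lemma sum_weakSum {R : Type*} [CommRing R] {p : ℤ → Prop} (hp : SignInvariant p)
    (hp' : ∀ v, 0 < v → p v) (q : Prop) (n : ℕ) (x y : R) :
    ∑ k ∈ range (n + 1), (-1 : R) ^ (n - k) * (n.choose k : R) * (y + 1) ^ (n - k) *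
      weakSum p q k x y = admSum p q (Icc (1 : ℤ) n) x :=
  binomial_inversion (y + 1) (fun k => weakSum p q k x y) (fun k => admSum p q (Icc (1 : ℤ) k) x)
    (fun n => weakSum_eq hp hp' q n x y) n

/-! ### Feasible partitions as full support -/

lemma isFeasible_iff {s : Finset ℤ} {P : Finpartition s} :
    IsFeasible P ↔ ∀ v ∈ s, ∃ a ∈ arcs P, a.1 = v ∨ a.2 = v := by
  constructor
  · intro h v hv
    rw [exists_arc_iff hv]
    have h2 : 1 < (P.part v).card := h _ (P.part_mem.2 hv)
    obtain ⟨w, hw, hne⟩ := exists_mem_ne h2 v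
    exact ⟨w, hw, hne⟩
  · intro h B hB
    obtain ⟨v, hv⟩ := P.nonempty_of_mem_parts hB
    obtain ⟨w, hw, hne⟩ := (exists_arc_iff (P.le hB hv)).1 (h v (P.le hB hv))
    rw [P.part_eq_of_mem hB hv] at hw
    exact one_lt_card.2 ⟨w, hw, v, hv, hne⟩

lemma Fe_eq {R : Type*} [CommRing R] (n : ℕ) (x : R) :
    Fe n x = admSum (fun i => 0 < i) False (Icc (1 : ℤ) n) x := by
  classical
  rw [Fe, admSum]
  refine sum_nbij arcs ?_ (fun P _ Q _ h => arcs_injective h) ?_ fun _ _ => rfl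
  · intro P hP
    have hP := isFeasible_iff.1 (mem_filter.1 hP).2
    have hA := isArcSet_arcs P
    have hpos : ∀ c ∈ arcs P, 0 < c.1 ∧ c.1 < c.2 ∧ c.2 ≤ n := by
      intro c hc
      have h1 := hA.left_mem c hc
      have h2 := hA.right_mem c hc
      have h3 := hA.lt c hc
      simp only [groundA, mem_Icc] at h1 h2
      omega
    refine mem_adm.2 ⟨⟨?_, fun c hc => (hpos c hc).1, hA.inj_left, hA.inj_right, ?_,
      False.elim⟩, ?_⟩
    · intro c hc
      have := hpos c hc
      grind
    · intro c hc d hd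
      have := hpos c hc
      have := hpos d hd
      omega
    · ext v
      rw [mem_supp]
      constructor
      · rintro ⟨hv, c, hc, h⟩
        have := hpos c hc
        rw [mem_Icc]
        grind
      · intro hv
        obtain ⟨c, hc, h⟩ := hP v hv
        have := hpos c hc
        exact ⟨by grind, c, hc, by grind⟩
  · intro C hC
    rw [mem_coe, mem_adm] at hC
    obtain ⟨h, hs⟩ := hC
    have hmem : ∀ v ∈ supp C, 1 ≤ v ∧ v ≤ n := fun v hv => by
      rw [hs, mem_Icc] at hv
      exact hv
    have hpos : ∀ c ∈ C, 0 < c.1 ∧ c.1 < c.2 ∧ c.2 ≤ n := by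
      intro c hc
      have h1 := h.lt c hc
      have h2 := h.src c hc
      have := hmem c.2 (mem_supp.2 ⟨by grind, c, hc, .inr rfl⟩)
      grind
    have hA : IsArcSet (groundA n) C := by
      refine ⟨?_, ?_, fun c hc => (hpos c hc).2.1, h.inj_left, h.inj_right⟩ <;> intro c hc <;>
        have := hpos c hc <;> simp only [groundA, mem_Icc] <;> omega
    obtain ⟨P, hP⟩ := exists_arcs_eq hA
    refine ⟨P, ?_, hP⟩
    simp only [coe_filter, mem_univ, true_and, Set.mem_ofPred_eq]
    rw [isFeasible_iff, hP]
    intro v hv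
    change v ∈ Icc (1 : ℤ) n at hv
    rw [← hs, mem_supp] at hv
    obtain ⟨-, c, hc, h⟩ := hv
    have := hpos c hc
    exact ⟨c, hc, by grind⟩

/-- A missing `v` in the support means that `{v}` is a block. Conversely, if `|v|` is in the
support, then `{v}` cannot be a block, nor can `{0, v}`, since symmetry would bring `-v` into it. -/
lemma IsSymm.isBFeasible_iff {n : ℕ} {P : Finpartition (groundB n)} (hP : IsSymm P) :
    IsBFeasible P ↔ supp (half (arcs P)) = Icc (1 : ℤ) n := by
  have hA := isArcSet_arcs P
  have hsub : ∀ v ∈ supp (half (arcs P)), 1 ≤ v ∧ v ≤ n := by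
    intro v hv
    obtain ⟨hv, c, hc, h⟩ := mem_supp.1 hv
    rw [mem_half] at hc
    have h1 := hA.left_mem c hc.1
    have h2 := hA.right_mem c hc.1
    simp only [groundB, mem_Icc] at h1 h2
    grind
  constructor
  · intro h
    ext v
    rw [mem_Icc]
    refine ⟨hsub v, fun hv => ?_⟩
    have hvs : v ∈ groundB n := by
      simp only [groundB, mem_Icc]
      omega
    by_contra hcon
    have hno : ¬ ∃ a ∈ arcs P, a.1 = v ∨ a.2 = v := by
      rintro ⟨a, ha, hav⟩
      refine hcon (mem_supp.2 ⟨by omega, ?_⟩)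
      rcases lt_or_ge |a.1| a.2 with h3 | h3
      · exact ⟨a, mem_half.2 ⟨ha, h3⟩, by grind⟩
      · have h1 := hP.2 a ha
        have h2 := hA.lt a ha
        exact ⟨_, mem_half.2 ⟨hP.1 a ha, by simp only [abs_neg]; grind⟩, by grind⟩
    rw [exists_arc_iff hvs] at hno
    refine h _ (P.part_mem.2 hvs) (card_eq_one.2 ⟨v, ?_⟩)
    ext w
    simp only [mem_erase, mem_singleton]
    constructor
    · rintro ⟨-, hw⟩
      by_contra hwv
      exact hno ⟨w, hw, hwv⟩
    · rintro rfl
      exact ⟨by omega, P.mem_part_self.2 hvs⟩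
  · intro h B hB hcard
    obtain ⟨v, hv⟩ := card_eq_one.1 hcard
    have hvB : v ∈ B.erase 0 := hv ▸ mem_singleton_self v
    obtain ⟨hv0, hvB⟩ := mem_erase.1 hvB
    have hvs := P.le hB hvB
    have hB' := P.part_eq_of_mem hB hvB
    have honly : ∀ w ∈ B, w = 0 ∨ w = v := by
      intro w hw
      by_contra hcon
      push Not at hcon
      have : w ∈ B.erase 0 := mem_erase.2 ⟨hcon.1, hw⟩
      rw [hv, mem_singleton] at this
      exact hcon.2 this
    have hvs' := hvs
    simp only [groundB, mem_Icc] at hvs'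
    have h1 : |v| ∈ supp (half (arcs P)) := by
      rw [h, mem_Icc]
      grind
    obtain ⟨-, c, hc, hcv⟩ := mem_supp.1 h1
    obtain ⟨hc, hlt⟩ := mem_half.1 hc
    have h2 : ∃ a ∈ arcs P, a.1 = v ∨ a.2 = v := by
      by_cases h4 : c.1 = v ∨ c.2 = v
      · exact ⟨c, hc, h4⟩
      · exact ⟨_, hP.1 c hc, by grind⟩
    obtain ⟨a, ha, hav⟩ := h2
    have h3 : ∀ w, w ∈ P.part v → w = 0 ∨ w = v := by
      rw [hB']
      exact honly
    have hlt' := hA.lt a ha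
    have hm := (mem_arcs.1 ha).1
    have hm' := (mem_arcs.1 (hP.1 a ha)).1
    simp only at hm'
    -- The arc at `v` can only lead to or from 0; its mirror image then joins 0 to `-v`.
    have h0 : (0 : ℤ) ∈ P.part v ∧ -v ∈ P.part 0 := by
      rcases hav with hav | hav
      · rw [hav] at hm hm' hlt'
        rcases h3 _ hm with h4 | h4
        · rw [h4] at hm hm'
          exact ⟨hm, by simpa using hm'⟩
        · omega
      · rw [hav] at hm hm' hlt'
        have hm := mem_part_symm hm
        rcases h3 _ hm with h4 | h4
        · rw [h4] at hm hm'
          exact ⟨hm, by simpa using mem_part_symm hm'⟩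
        · omega
    rw [part_eq P h0.1] at h0
    have := h3 _ h0.2
    omega

lemma FeTildeB_eq {R : Type*} [CommRing R] (n : ℕ) (x : R) :
    FeTildeB n x = admSum (fun _ => True) False (Icc (1 : ℤ) n) x := by
  rw [FeTildeB, admSum]
  refine sum_isSymm groundB_neg _ _ ?_ ?_ _ _ fun P hP => by rw [hP.card_arcs]
  · intro C hC
    rw [mem_adm] at hC
    refine mem_halves.2 ⟨fun c hc => ?_, hC.1⟩
    have hlt := hC.1.lt c hc
    have h : c.2 ∈ supp C := mem_supp.2 ⟨by grind, c, hc, .inr rfl⟩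
    rw [hC.2, mem_Icc] at h
    simp only [mem_product, groundB, mem_Icc]
    grind
  · intro P
    simp only [PiB, mem_filter, mem_univ, true_and, mem_adm]
    refine and_congr_right fun h => ?_
    rw [h.isBFeasible_iff]
    exact (and_iff_right (mem_halves.1 h.half_mem).2).symm

/-! ### A factor 2 for each signed source -/

/-- The admissible sets with targets in `{1, …, n}`. -/
noncomputable def full (p : ℤ → Prop) (n : ℕ) : Finset (Finset (ℤ × ℤ)) :=
  open Classical in (Icc (-n : ℤ) n ×ˢ Icc (1 : ℤ) n).powerset.filter (Adm p False)

lemma mem_full {p : ℤ → Prop} {n : ℕ} {C : Finset (ℤ × ℤ)} :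
    C ∈ full p n ↔ (∀ c ∈ C, c.2 ≤ n) ∧ Adm p False C := by
  simp only [full, mem_filter, mem_powerset]
  refine and_congr_left fun h => ⟨fun hC c hc => ?_, fun hC c hc => ?_⟩
  · have := hC hc
    simp only [mem_product, mem_Icc] at this
    exact this.2.2
  · have h1 := hC c hc
    have h2 := h.lt c hc
    simp only [mem_product, mem_Icc]
    grind

lemma sum_full {R : Type*} [CommRing R] {p : ℤ → Prop} (hp : SignInvariant p) (n : ℕ) (x : R) :
    ∑ C ∈ full p n, x ^ C.card =
      ∑ k ∈ range (n + 1), (n.choose k : R) * (1 ^ (n - k) * admSum p False (Icc (1 : ℤ) k) x) := by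
  have hsupp : ∀ C ∈ full p n, supp C ⊆ Icc (1 : ℤ) n := by
    intro C hC v hv
    rw [mem_full] at hC
    have h0 := hC.2.supp_pos hv
    obtain ⟨-, c, hc, h⟩ := mem_supp.1 hv
    have h1 := hC.1 c hc
    have h2 := hC.2.lt c hc
    rw [mem_Icc]
    grind
  rw [← sum_fiberwise_of_maps_to (t := (Icc (1 : ℤ) n).powerset) (g := supp)
    fun C hC => mem_powerset.2 (hsupp C hC)]
  trans ∑ T ∈ (Icc (1 : ℤ) n).powerset,
    (fun k : ℕ => admSum p False (Icc (1 : ℤ) k) x) T.card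
  · refine sum_congr rfl fun T hT => ?_
    dsimp only
    rw [mem_powerset] at hT
    rw [← admSum_eq_card hp, admSum]
    · refine sum_congr ?_ fun _ _ => rfl
      ext C
      rw [mem_filter, mem_full, mem_adm]
      refine ⟨fun h => ⟨h.1.2, h.2⟩, fun h => ⟨⟨fun c hc => ?_, h.1⟩, h.2⟩⟩
      have hlt := h.1.lt c hc
      have : c.2 ∈ supp C := mem_supp.2 ⟨by grind, c, hc, .inr rfl⟩
      rw [h.2] at this
      exact (mem_Icc.1 (hT this)).2
    · intro v hv
      have := mem_Icc.1 (hT hv)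
      omega
  · generalize hF : (fun k : ℕ => admSum p False (Icc (1 : ℤ) k) x) = F
    rw [sum_powerset_apply_card, ← hF]
    simp [nsmul_eq_mul]

/-- The possible sources of a new arc with target `n + 1`. -/
noncomputable def free (p : ℤ → Prop) (n : ℕ) (C : Finset (ℤ × ℤ)) : Finset ℤ :=
  open Classical in
  (Icc (-n : ℤ) n).filter fun v => p v ∧ (∀ c ∈ C, c.1 ≠ v) ∧ ∀ c ∈ C, c.2 ≠ -v

/-- Either `n + 1` is not a target, or exactly one arc ends there; deleting that arc leaves its
source among the free ones. -/
lemma sum_full_succ {M : Type*} [AddCommMonoid M] (p : ℤ → Prop) (n : ℕ) (w : ℕ → M) :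
    ∑ C ∈ full p (n + 1), w C.card =
      ∑ C ∈ full p n, (w C.card + (free p n C).card • w (C.card + 1)) := by
  classical
  rw [← sum_filter_add_sum_filter_not (full p (n + 1)) (fun C => ∀ c ∈ C, c.2 ≤ n),
    sum_add_distrib]
  congr 1
  · refine sum_congr ?_ fun _ _ => rfl
    ext C
    rw [mem_filter, mem_full, mem_full]
    push_cast
    exact ⟨fun h => ⟨h.2, h.1.2⟩, fun h => ⟨⟨fun c hc => (h.1 c hc).trans (by simp), h.2⟩, h.1⟩⟩
  · simp_rw [← sum_const]
    rw [sum_sigma']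
    symm
    have hfresh : ∀ C ∈ full p n, ∀ v, (v, (n : ℤ) + 1) ∉ C := by
      intro C hC v h
      have := (mem_full.1 hC).1 _ h
      simp at this
    have hrec : ∀ C ∈ full p n, ∀ v, (insert (v, (n : ℤ) + 1) C).filter (fun c : ℤ × ℤ => c.2 ≤ (n : ℤ)) = C := by
      intro C hC v
      ext c
      have := (mem_full.1 hC).1 c
      simp only [mem_filter, mem_insert]
      grind
    refine sum_nbij (fun z => insert (z.2, (n : ℤ) + 1) z.1) ?_ ?_ ?_ ?_
    · rintro ⟨C, v⟩ h
      rw [mem_sigma] at h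
      obtain ⟨hC, hv⟩ := h
      simp only [mem_full, free, mem_filter, mem_Icc] at hC hv
      obtain ⟨hn, hC⟩ := hC
      obtain ⟨hv, hpv, h1, h2⟩ := hv
      rw [mem_filter, mem_full]
      refine ⟨⟨?_, ?_, ?_, ?_, ?_, ?_, False.elim⟩, ?_⟩
      · intro c hc
        rcases mem_insert.1 hc with rfl | hc
        · simp
        · have := hn c hc
          push_cast
          omega
      · intro c hc
        rcases mem_insert.1 hc with rfl | hc
        · grind
        · exact hC.lt c hc
      · intro c hc
        rcases mem_insert.1 hc with rfl | hc
        · exact hpv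
        · exact hC.src c hc
      · intro c hc d hd hcd
        rcases mem_insert.1 hc with rfl | hc <;> rcases mem_insert.1 hd with rfl | hd
        · rfl
        · exact absurd hcd.symm (h1 d hd)
        · exact absurd hcd (h1 c hc)
        · exact hC.inj_left c hc d hd hcd
      · intro c hc d hd hcd
        rcases mem_insert.1 hc with rfl | hc <;> rcases mem_insert.1 hd with rfl | hd
        · rfl
        · have := hn d hd
          grind
        · have := hn c hc
          grind
        · exact hC.inj_right c hc d hd hcd
      · intro c hc d hd
        rcases mem_insert.1 hc with rfl | hc <;> rcases mem_insert.1 hd with rfl | hd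
        · grind
        · have := hn d hd
          have := hC.lt d hd
          grind
        · exact h2 c hc
        · exact hC.disj c hc d hd
      · intro h
        have := h _ (mem_insert_self _ _)
        simp at this
    · rintro ⟨C, v⟩ h ⟨D, u⟩ h' heq
      simp only [coe_sigma, Set.mem_sigma_iff, mem_coe] at h h'
      simp only at heq
      have h1 : C = D := by
        rw [← hrec C h.1 v, ← hrec D h'.1 u, heq]
      subst h1
      have h2 : (v, (n : ℤ) + 1) ∈ insert (u, (n : ℤ) + 1) C := heq ▸ mem_insert_self _ _
      rcases mem_insert.1 h2 with h2 | h2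
      · simp only [Prod.mk.injEq, and_true] at h2
        rw [h2]
      · exact absurd h2 (hfresh C h.1 v)
    · intro D hD
      rw [mem_coe, mem_filter, mem_full] at hD
      obtain ⟨⟨hn, h⟩, hex⟩ := hD
      push Not at hex
      obtain ⟨⟨v, m⟩, hvm, hm⟩ := hex
      have hm : m = (n : ℤ) + 1 := by
        have := hn _ hvm
        push_cast at this
        simp only at hm this
        omega
      subst hm
      have hother : ∀ c ∈ D.erase (v, (n : ℤ) + 1), c.2 ≤ n := by
        intro c hc
        obtain ⟨hne, hc⟩ := mem_erase.1 hc
        have h1 := hn c hc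
        have h2 := h.inj_right c hc _ hvm
        push_cast at h1
        grind
      refine ⟨⟨D.erase (v, (n : ℤ) + 1), v⟩, ?_, insert_erase hvm⟩
      simp only [coe_sigma, Set.mem_sigma_iff, mem_coe, mem_full, free, mem_filter, mem_Icc]
      refine ⟨⟨hother, ⟨fun c hc => h.lt c (mem_of_mem_erase hc),
        fun c hc => h.src c (mem_of_mem_erase hc),
        fun c hc d hd => h.inj_left c (mem_of_mem_erase hc) d (mem_of_mem_erase hd),
        fun c hc d hd => h.inj_right c (mem_of_mem_erase hc) d (mem_of_mem_erase hd),
        fun c hc d hd => h.disj c (mem_of_mem_erase hc) d (mem_of_mem_erase hd), False.elim⟩⟩,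
        ?_, h.src _ hvm, ?_, ?_⟩
      · have := h.lt _ hvm
        grind
      · intro c hc hcv
        obtain ⟨hne, hc⟩ := mem_erase.1 hc
        exact hne (h.inj_left c hc _ hvm hcv)
      · intro c hc
        exact h.disj c (mem_of_mem_erase hc) _ hvm
    · rintro ⟨C, v⟩ h
      rw [mem_sigma] at h
      rw [card_insert_of_notMem (hfresh C h.1 v)]

lemma card_free_pos {n : ℕ} {C : Finset (ℤ × ℤ)} (hC : C ∈ full (fun i => 0 < i) n) :
    (free (fun i => 0 < i) n C).card + C.card = n := by
  obtain ⟨hn, h⟩ := mem_full.1 hC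
  have h1 : free (fun i => 0 < i) n C = Icc (1 : ℤ) n \ C.image Prod.fst := by
    ext v
    simp only [free, mem_filter, mem_sdiff, mem_Icc, mem_image, not_exists, not_and]
    have : 0 < v → ∀ c ∈ C, c.2 ≠ -v := by
      intro hv c hc
      have := h.lt c hc
      grind
    grind
  have h2 : C.image Prod.fst ⊆ Icc (1 : ℤ) n := by
    intro v hv
    obtain ⟨c, hc, rfl⟩ := mem_image.1 hv
    have := hn c hc
    have := h.lt c hc
    have := h.src c hc
    rw [mem_Icc]
    grind
  have h3 : (C.image Prod.fst).card = C.card :=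
    card_image_of_injOn fun c hc d hd => h.inj_left c hc d hd
  have h4 := card_le_card h2
  rw [h1, card_sdiff_of_subset h2, h3]
  rw [h3] at h4
  simp at h4 ⊢
  omega

/-- Each arc blocks two nonzero values, its source and the negative of its target, and by `disj`
these never coincide. -/
lemma card_free_ne {n : ℕ} {C : Finset (ℤ × ℤ)} (hC : C ∈ full (fun i => i ≠ 0) n) :
    (free (fun i => i ≠ 0) n C).card + 2 * C.card = 2 * n := by
  obtain ⟨hn, h⟩ := mem_full.1 hC
  have h1 : free (fun i => i ≠ 0) n C =
      (Icc (-n : ℤ) n).erase 0 \ (C.image Prod.fst ∪ C.image fun c => -c.2) := by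
    ext v
    simp only [free, mem_filter, mem_sdiff, mem_Icc, mem_image, mem_erase, mem_union]
    grind
  have h2 : C.image Prod.fst ∪ (C.image fun c => -c.2) ⊆ (Icc (-n : ℤ) n).erase 0 := by
    intro v hv
    simp only [mem_union, mem_image] at hv
    rw [mem_erase, mem_Icc]
    rcases hv with ⟨c, hc, rfl⟩ | ⟨c, hc, rfl⟩ <;> have := hn c hc <;> have := h.lt c hc <;>
      have := h.src c hc <;> grind
  have h3 : (C.image Prod.fst ∪ C.image fun c => -c.2).card = 2 * C.card := by
    rw [card_union_of_disjoint, card_image_of_injOn, card_image_of_injOn, two_mul]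
    · exact fun c hc d hd hcd => h.inj_right c hc d hd (neg_injective hcd)
    · exact fun c hc d hd => h.inj_left c hc d hd
    · rw [disjoint_left]
      intro v hv hv'
      obtain ⟨c, hc, rfl⟩ := mem_image.1 hv
      obtain ⟨d, hd, hdc⟩ := mem_image.1 hv'
      exact h.disj d hd c hc (by omega)
  have h4 := card_le_card h2
  have h5 : ((Icc (-n : ℤ) n).erase 0).card = 2 * n := by
    rw [card_erase_of_mem (by simp)]
    simp
    omega
  rw [h1, card_sdiff_of_subset h2, h3, h5]
  rw [h3, h5] at h4
  omega

/-- No direct bijection by signs is used, since a positive source may be a target while its negative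
may then not be a source. The counts of free sources agree up to the factor 2, which suffices for
induction over arbitrary weights. -/
lemma sum_full_ne {R : Type*} [CommRing R] (n : ℕ) (w : ℕ → R) :
    ∑ C ∈ full (fun i => i ≠ 0) n, w C.card =
      ∑ C ∈ full (fun i => 0 < i) n, 2 ^ C.card * w C.card := by
  induction n generalizing w with
  | zero =>
    have : ∀ p, full p 0 = {∅} := by
      intro p
      ext C
      rw [mem_full, mem_singleton]
      constructor
      · rintro ⟨h1, h2⟩
        refine eq_empty_of_forall_notMem fun c hc => ?_
        have := h1 c hc
        have := h2.lt c hc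
        grind
      · rintro rfl
        exact ⟨by simp, ⟨by simp, by simp, by simp, by simp, by simp, by simp⟩⟩
    simp [this]
  | succ n ih =>
    rw [sum_full_succ _ n w, sum_full_succ _ n fun k => 2 ^ k * w k]
    have h1 : ∀ C ∈ full (fun i => i ≠ 0) n,
        w C.card + (free (fun i => i ≠ 0) n C).card • w (C.card + 1) =
        (fun k : ℕ => w k + (2 * n - 2 * k : R) * w (k + 1)) C.card := by
      intro C hC
      have := congrArg (Nat.cast : ℕ → R) (card_free_ne hC)
      push_cast at this
      rw [nsmul_eq_mul, eq_sub_of_add_eq this]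
    have h2 : ∀ C ∈ full (fun i => 0 < i) n,
        2 ^ C.card * w C.card +
          (free (fun i => 0 < i) n C).card • (2 ^ (C.card + 1) * w (C.card + 1)) =
        2 ^ C.card * (fun k : ℕ => w k + (2 * n - 2 * k : R) * w (k + 1)) C.card := by
      intro C hC
      have := congrArg (Nat.cast : ℕ → R) (card_free_pos hC)
      push_cast at this
      rw [nsmul_eq_mul, eq_sub_of_add_eq this]
      ring
    rw [sum_congr rfl h1, sum_congr rfl h2]
    -- Both recursions lead to the same new weight, which is why the induction must generalize `w`.
    exact ih fun k => w k + (2 * n - 2 * k : R) * w (k + 1)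

/-- Binomial inversion with `z = 1` passes from supports contained in `[n]` to support equal to
`[n]`. -/
lemma admSum_ne_eq {R : Type*} [CommRing R] (n : ℕ) (x : R) :
    admSum (fun i => i ≠ 0) False (Icc (1 : ℤ) n) x =
      admSum (fun i => 0 < i) False (Icc (1 : ℤ) n) (2 * x) := by
  rw [← binomial_inversion 1 _ (fun k => admSum (fun i => i ≠ 0) False (Icc (1 : ℤ) k) x)
      (fun k => sum_full signInvariant_ne k x) n,
    ← binomial_inversion 1 _ (fun k => admSum (fun i => 0 < i) False (Icc (1 : ℤ) k) (2 * x))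
      (fun k => sum_full signInvariant_pos k (2 * x)) n]
  refine sum_congr rfl fun k _ => ?_
  rw [sum_full_ne k fun k => x ^ k]
  simp_rw [mul_pow]

/-! ### Noncrossing configurations: recursion at the greatest element -/

/-- Gluing noncrossing admissible sets below and above `|i|` with an arc from `i` over the
second. -/
lemma Adm.glue {p : ℤ → Prop} {C D : Finset (ℤ × ℤ)} (hC : Adm p True C)
    (hD : Adm (fun j => 0 < j) True D) (hp : ∀ v, 0 < v → p v) {N i : ℤ} (hi : |i| < N)
    (hpi : p i) (hl : ∀ c ∈ C, |c.1| < c.2 ∧ c.2 < |i|)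
    (hh : ∀ c ∈ D, |i| < c.1 ∧ c.1 < c.2 ∧ c.2 < N) :
    Adm p True (insert (i, N) (C ∪ D)) := by
  have h0 := abs_nonneg i
  refine ⟨?_, ?_, ?_, ?_, ?_, ?_⟩
  · intro c hc
    have := hl c
    have := hh c
    simp only [mem_insert, mem_union] at hc
    grind
  · intro c hc
    have := hC.src c
    have := hD.src c
    simp only [mem_insert, mem_union] at hc
    grind
  · intro c hc d hd hcd
    have h1 := hC.inj_left c
    have h2 := hD.inj_left c
    have := hl c
    have := hh c
    have := hl d
    have := hh d
    simp only [mem_insert, mem_union] at hc hd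
    rcases hc with rfl | hc | hc <;> rcases hd with rfl | hd | hd <;> grind
  · intro c hc d hd hcd
    have h1 := hC.inj_right c
    have h2 := hD.inj_right c
    have := hl c
    have := hh c
    have := hl d
    have := hh d
    simp only [mem_insert, mem_union] at hc hd
    rcases hc with rfl | hc | hc <;> rcases hd with rfl | hd | hd <;> grind
  · intro c hc d hd
    have h1 := hC.disj c
    have h2 := hD.disj c
    have := hl c
    have := hh c
    have := hl d
    have := hh d
    simp only [mem_insert, mem_union] at hc hd
    rcases hc with rfl | hc | hc <;> rcases hd with rfl | hd | hd <;> grind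
  · intro _ c hc d hd hlt
    have h1 := hC.nc trivial c
    have h2 := hD.nc trivial c
    have := hl c
    have := hh c
    have := hl d
    have := hh d
    simp only [mem_insert, mem_union] at hc hd
    rcases hc with rfl | hc | hc <;> rcases hd with rfl | hd | hd <;> grind

set_option maxHeartbeats 1000000 in
/-- The noncrossing admissible sets of `{1, …, N}` in which `N` is joined to `i` split into a part
below `|i|` and a part between `|i|` and `N`. -/
lemma sum_adm_top {R : Type*} [CommRing R] {p : ℤ → Prop} (hp : ∀ v, 0 < v → p v) {N i : ℤ}
    (hi : |i| < N) (hpi : p i) (x : R) :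
    ∑ C ∈ adm p True (Icc 1 N) with (i, N) ∈ C, x ^ C.card =
      x * (admSum p True (Icc 1 (|i| - 1)) x * admSum (fun j => 0 < j) True (Ioo |i| N) x) := by
  rw [admSum, admSum, sum_mul_sum, ← sum_product', mul_sum]
  have h0 := abs_nonneg i
  have hbd : ∀ (r : ℤ → Prop) (a b : ℤ), 0 ≤ a → ∀ C ∈ adm r True (Ioo a b), ∀ c ∈ C,
      (c.1 = 0 ∨ a < |c.1|) ∧ |c.1| < c.2 ∧ c.2 < b := by
    intro r a b ha C hC c hc
    obtain ⟨h, hs⟩ := mem_adm.1 hC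
    have hlt := h.lt c hc
    have h1 : c.2 ∈ supp C := mem_supp.2 ⟨by grind, c, hc, .inr rfl⟩
    have h2 : c.1 ≠ 0 → |c.1| ∈ supp C := fun h => mem_supp.2 ⟨by simpa using h, c, hc, .inl rfl⟩
    rw [hs, mem_Ioo] at h1 h2
    refine ⟨?_, hlt, h1.2⟩
    by_cases hc0 : c.1 = 0
    · exact .inl hc0
    · exact .inr (h2 hc0).1
  have hlow : ∀ C ∈ adm p True (Icc 1 (|i| - 1)), ∀ c ∈ C, |c.1| < c.2 ∧ c.2 < |i| := by
    intro C hC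
    have : Icc 1 (|i| - 1) = Ioo 0 |i| := by
      ext v
      rw [mem_Icc, mem_Ioo]
      omega
    rw [this] at hC
    exact fun c hc => (hbd p 0 |i| le_rfl C hC c hc).2
  have hhigh : ∀ C ∈ adm (fun j => 0 < j) True (Ioo |i| N), ∀ c ∈ C,
      |i| < c.1 ∧ c.1 < c.2 ∧ c.2 < N := by
    intro C hC c hc
    have h1 := hbd _ |i| N h0 C hC c hc
    have h2 := (mem_adm.1 hC).1.src c hc
    grind
  -- This is the noncrossing condition `nc` applied to each other arc and `(i, N)`, which has the
  -- greatest target.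
  have hsplit : ∀ C ∈ adm p True (Icc 1 N), (i, N) ∈ C → ∀ c ∈ C,
      c = (i, N) ∨ (|c.1| < c.2 ∧ c.2 < |i|) ∨ (|i| < c.1 ∧ c.1 < c.2 ∧ c.2 < N) := by
    intro C hC hiN c hc
    obtain ⟨h, hs⟩ := mem_adm.1 hC
    have hlt := h.lt c hc
    have h1 : c.2 ∈ supp C := mem_supp.2 ⟨by grind, c, hc, .inr rfl⟩
    rw [hs, mem_Icc] at h1
    have h2 := h.inj_right c hc _ hiN
    have h3 := h.nc trivial c hc _ hiN
    grind
  have hsub : ∀ {r r' : ℤ → Prop} {C : Finset (ℤ × ℤ)} (s : ℤ × ℤ → Prop) [DecidablePred s],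
      Adm r True C → (∀ c ∈ C, s c → r' c.1) → Adm r' True (C.filter s) := by
    intro r r' C s _ h hr
    exact ⟨fun c hc => h.lt c (mem_filter.1 hc).1,
      fun c hc => hr c (mem_filter.1 hc).1 (mem_filter.1 hc).2,
      fun c hc d hd => h.inj_left c (mem_filter.1 hc).1 d (mem_filter.1 hd).1,
      fun c hc d hd => h.inj_right c (mem_filter.1 hc).1 d (mem_filter.1 hd).1,
      fun c hc d hd => h.disj c (mem_filter.1 hc).1 d (mem_filter.1 hd).1,
      fun hq c hc d hd => h.nc hq c (mem_filter.1 hc).1 d (mem_filter.1 hd).1⟩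
  have hfil1 : ∀ z ∈ adm p True (Icc 1 (|i| - 1)) ×ˢ adm (fun j => 0 < j) True (Ioo |i| N),
      (insert (i, N) (z.1 ∪ z.2)).filter (fun c => c.2 < |i|) = z.1 := by
    intro z hz
    rw [mem_product] at hz
    ext c
    have h1 := hlow _ hz.1 c
    have h2 := hhigh _ hz.2 c
    simp only [mem_filter, mem_insert, mem_union]
    grind
  have hfil2 : ∀ z ∈ adm p True (Icc 1 (|i| - 1)) ×ˢ adm (fun j => 0 < j) True (Ioo |i| N),
      (insert (i, N) (z.1 ∪ z.2)).filter (fun c => |i| < c.1 ∧ c.2 < N) = z.2 := by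
    intro z hz
    rw [mem_product] at hz
    ext c
    have h1 := hlow _ hz.1 c
    have h2 := hhigh _ hz.2 c
    simp only [mem_filter, mem_insert, mem_union]
    grind
  have hrec : ∀ C ∈ adm p True (Icc 1 N), (i, N) ∈ C →
      insert (i, N) (C.filter (fun c => c.2 < |i|) ∪ C.filter fun c => |i| < c.1 ∧ c.2 < N) =
        C := by
    intro C hC hiN
    ext c
    have := hsplit C hC hiN c
    simp only [mem_filter, mem_insert, mem_union]
    grind
  have hback : ∀ z ∈ adm p True (Icc 1 (|i| - 1)) ×ˢ adm (fun j => 0 < j) True (Ioo |i| N),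
      insert (i, N) (z.1 ∪ z.2) ∈ adm p True (Icc 1 N) := by
    rintro ⟨C, D⟩ hz
    rw [mem_product] at hz
    have hl := hlow _ hz.1
    have hh := hhigh _ hz.2
    obtain ⟨⟨hC, hCs⟩, hD, hDs⟩ := hz.imp mem_adm.1 mem_adm.1
    simp only at hl hh hC hCs hD hDs ⊢
    rw [mem_adm]
    refine ⟨hC.glue hD hp hi hpi hl hh, ?_⟩
    · ext v
      rw [mem_Icc, mem_supp]
      simp only [mem_insert, mem_union]
      constructor
      · rintro ⟨hv, c, hc, h⟩
        have := hl c
        have := hh c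
        grind
      · intro hv
        refine ⟨by omega, ?_⟩
        rcases lt_trichotomy v |i| with h | h | h
        · have : v ∈ supp C := by
            rw [hCs, mem_Icc]
            omega
          obtain ⟨-, c, hc, h⟩ := mem_supp.1 this
          exact ⟨c, .inr (.inl hc), h⟩
        · exact ⟨_, .inl rfl, .inl h.symm⟩
        · rcases hv.2.eq_or_lt with h' | h'
          · exact ⟨_, .inl rfl, .inr h'.symm⟩
          · have : v ∈ supp D := by
              rw [hDs, mem_Ioo]
              omega
            obtain ⟨-, c, hc, h⟩ := mem_supp.1 this
            exact ⟨c, .inr (.inr hc), h⟩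
  refine sum_nbij' (fun C => (C.filter (fun c => c.2 < |i|),
    C.filter fun c => |i| < c.1 ∧ c.2 < N)) (fun z => insert (i, N) (z.1 ∪ z.2)) ?_ ?_ ?_ ?_ ?_
  · intro C hC
    obtain ⟨hC, hiN⟩ := mem_filter.1 hC
    have hsp := hsplit C hC hiN
    obtain ⟨h, hs⟩ := mem_adm.1 hC
    rw [mem_product, mem_adm, mem_adm]
    refine ⟨⟨hsub _ h fun c hc _ => h.src c hc, ?_⟩, hsub _ h fun c hc hic => by omega, ?_⟩
    · ext v
      rw [mem_Icc, mem_supp]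
      constructor
      · rintro ⟨hv, c, hc, h'⟩
        obtain ⟨hc, hc'⟩ := mem_filter.1 hc
        have := h.lt c hc
        grind
      · intro hv
        have : v ∈ supp C := by
          rw [hs, mem_Icc]
          omega
        obtain ⟨-, c, hc, h'⟩ := mem_supp.1 this
        have := hsp c hc
        exact ⟨by omega, c, mem_filter.2 ⟨hc, by grind⟩, h'⟩
    · ext v
      rw [mem_Ioo, mem_supp]
      constructor
      · rintro ⟨hv, c, hc, h'⟩
        obtain ⟨hc, hc'⟩ := mem_filter.1 hc
        have := h.lt c hc
        grind
      · intro hv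
        have : v ∈ supp C := by
          rw [hs, mem_Icc]
          omega
        obtain ⟨-, c, hc, h'⟩ := mem_supp.1 this
        have := hsp c hc
        exact ⟨by omega, c, mem_filter.2 ⟨hc, by grind⟩, h'⟩
  · exact fun z hz => mem_filter.2 ⟨hback z hz, mem_insert_self _ _⟩
  · exact fun C hC => hrec C (mem_filter.1 hC).1 (mem_filter.1 hC).2
  · exact fun z hz => Prod.ext (hfil1 z hz) (hfil2 z hz)
  · intro C hC
    obtain ⟨hC, hiN⟩ := mem_filter.1 hC
    conv_lhs => rw [← hrec C hC hiN]
    rw [card_insert_of_notMem, card_union_of_disjoint, pow_succ, pow_add, mul_comm]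
    · rw [disjoint_left]
      intro c hc hc'
      have h1 := (mem_filter.1 hc).2
      have h2 := (mem_filter.1 hc').2
      have := (mem_adm.1 hC).1.lt c (mem_filter.1 hc).1
      grind
    · simp only [mem_union, mem_filter]
      grind

lemma admSum_succ {R : Type*} [CommRing R] {p : ℤ → Prop} [DecidablePred p]
    (hp : ∀ v, 0 < v → p v) (n : ℕ) (x : R) :
    admSum p True (Icc (1 : ℤ) (n + 1 : ℕ)) x =
      ∑ i ∈ Icc (-n : ℤ) n, if p i then
        x * (admSum p True (Icc 1 (|i| - 1)) x *
          admSum (fun j => 0 < j) True (Ioo |i| (n + 1)) x) else 0 := by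
  classical
  push_cast
  rw [← sum_filter]
  trans ∑ i ∈ (Icc (-n : ℤ) n).filter p,
    ∑ C ∈ adm p True (Icc (1 : ℤ) (n + 1)) with (i, (n : ℤ) + 1) ∈ C, x ^ C.card
  · rw [admSum, ← sum_biUnion]
    · refine sum_congr ?_ fun _ _ => rfl
      ext C
      simp only [mem_biUnion, mem_filter]
      refine ⟨fun hC => ?_, fun ⟨_, _, h⟩ => h.1⟩
      obtain ⟨h, hs⟩ := mem_adm.1 hC
      have h1 : (n : ℤ) + 1 ∈ supp C := by
        rw [hs, mem_Icc]
        omega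
      -- The element `n + 1` cannot be the absolute value of a source, as targets are larger than
      -- that, so it is a target.
      obtain ⟨-, c, hc, h2⟩ := mem_supp.1 h1
      have hlt := h.lt c hc
      have h3 : c.2 ∈ supp C := mem_supp.2 ⟨by grind, c, hc, .inr rfl⟩
      rw [hs, mem_Icc] at h3
      have h4 : c.2 = n + 1 := by omega
      refine ⟨c.1, ⟨?_, h.src c hc⟩, hC, ?_⟩
      · rw [mem_Icc]
        grind
      · rw [← h4]
        exact hc
    · intro i _ j _ hij
      rw [Function.onFun, disjoint_left]
      intro C hC hC'
      rw [mem_filter] at hC hC'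
      have := (mem_adm.1 hC.1).1.inj_right _ hC.2 _ hC'.2 rfl
      simp only [Prod.mk.injEq, and_true] at this
      exact hij this
  · refine sum_congr rfl fun i hi => ?_
    rw [mem_filter, mem_Icc] at hi
    exact sum_adm_top hp (by grind) hi.2 x

lemma sum_Icc_neg {M : Type*} [AddCommMonoid M] (n : ℕ) (F : ℤ → M) :
    ∑ i ∈ Icc (-n : ℤ) n, F i = F 0 + ∑ a ∈ range n, (F (a + 1) + F (-(a + 1))) := by
  induction n with
  | zero => simp
  | succ n ih =>
    have : Icc (-((n + 1 : ℕ) : ℤ)) ((n + 1 : ℕ) : ℤ) =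
        insert ((n : ℤ) + 1) (insert (-((n : ℤ) + 1)) (Icc (-n : ℤ) n)) := by
      ext v
      simp only [mem_insert, mem_Icc]
      omega
    rw [this, sum_insert, sum_insert, ih, sum_range_succ]
    · abel
    · rw [mem_Icc]
      omega
    · rw [mem_insert, mem_Icc]
      omega

/-- The weight enumerator of the noncrossing admissible sets with support `{1, …, n}`. -/
noncomputable def ncSum {R : Type*} [CommRing R] (p : ℤ → Prop) (x : R) (n : ℕ) : R :=
  admSum p True (Icc (1 : ℤ) n) x

lemma ncSum_zero {R : Type*} [CommRing R] (p : ℤ → Prop) (x : R) : ncSum p x 0 = 1 := by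
  have : adm p True (Icc (1 : ℤ) (0 : ℕ)) = {∅} := by
    ext C
    rw [mem_adm, mem_singleton]
    constructor
    · rintro ⟨h, hs⟩
      refine eq_empty_of_forall_notMem fun c hc => ?_
      have hlt := h.lt c hc
      have h1 : c.2 ∈ supp C := mem_supp.2 ⟨by grind, c, hc, .inr rfl⟩
      simp [hs] at h1
    · rintro rfl
      exact ⟨⟨by simp, by simp, by simp, by simp, by simp, by simp⟩, by simp [supp]⟩
  rw [ncSum, admSum, this]
  simp

/-- The sources `±(a + 1)` of the arc into `n + 1` give equal terms; the factor 2 or 1 records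
whether the negative one is allowed. -/
lemma ncSum_succ {R : Type*} [CommRing R] {p : ℤ → Prop} [DecidablePred p]
    (hs : SignInvariant p) (hp : ∀ v, 0 < v → p v) (n : ℕ) (x : R) :
    ncSum p x (n + 1) = (if p 0 then x * ncSum (fun j => 0 < j) x n else 0) +
      (if p (-1) then 2 else 1) * x *
        ∑ a ∈ range n, ncSum p x a * ncSum (fun j => 0 < j) x (n - 1 - a) := by
  -- Multiplication by `a + 1` is odd and strictly increasing.
  have hneg : ∀ a : ℕ, p (-((a : ℤ) + 1)) ↔ p (-1) := by
    intro a
    have := hs (fun i => ((a : ℤ) + 1) * i) (fun i j h => by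
      have : (0 : ℤ) < a + 1 := by positivity
      exact (mul_lt_mul_iff_right₀ this).2 h) (fun i => by ring) (-1)
    simpa using this
  have hlow : ∀ a : ℕ, admSum p True (Icc 1 (|(a : ℤ) + 1| - 1)) x = ncSum p x a := by
    intro a
    rw [abs_of_pos (by positivity), add_sub_cancel_right, ncSum]
  have hhigh : ∀ a : ℕ, admSum (fun j => 0 < j) True (Ioo (a : ℤ) (n + 1)) x =
      ncSum (fun j => 0 < j) x (n - a) := by
    intro a
    rw [admSum_eq_card signInvariant_pos, ncSum, Int.card_Ioo]
    · congr
      omega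
    · intro v hv
      rw [mem_Ioo] at hv
      omega
  rw [ncSum, admSum_succ hp, sum_Icc_neg]
  congr 1
  · congr 1
    have h1 := hlow 0
    have h2 := hhigh 0
    have h3 : Icc (1 : ℤ) (|0| - 1) = Icc (1 : ℤ) (0 : ℕ) := by simp
    simp only [Nat.cast_zero, Nat.sub_zero] at h2
    rw [abs_zero, h2]
    rw [abs_zero] at h3
    rw [h3, ← ncSum, ncSum_zero, one_mul]
  · rw [mul_sum]
    refine sum_congr rfl fun a ha => ?_
    have h4 : |(a : ℤ) + 1| = ((a + 1 : ℕ) : ℤ) := by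
      push_cast
      exact abs_of_pos (by positivity)
    have h5 : n - (a + 1) = n - 1 - a := by omega
    rw [if_pos (hp _ (by positivity)), abs_neg, hlow, h4, hhigh, h5]
    simp only [hneg]
    split_ifs <;> ring

/-! ### Solving the recursion -/

lemma centralBinom_succ_eq (m : ℕ) : Nat.centralBinom (m + 1) = 2 * (2 * m + 1).choose m := by
  rw [Nat.centralBinom, show 2 * (m + 1) = (2 * m + 1) + 1 by ring, Nat.choose_succ_succ,
    Nat.choose_symm_half]
  ring

/-- The convolution of the Catalan numbers and the central binomial coefficients. -/
lemma sum_centralBinom_mul_catalan (m : ℕ) :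
    ∑ z ∈ antidiagonal m, Nat.centralBinom z.1 * catalan z.2 = (2 * m + 1).choose m := by
  have h1 : 2 * ∑ z ∈ antidiagonal m, Nat.centralBinom z.1 * catalan z.2 =
      (m + 2) * catalan (m + 1) := by
    rw [two_mul, catalan_succ', mul_sum]
    -- Symmetrize: for `a + b = m` the central binomials are `(a + 1)` and `(b + 1)` times Catalan
    -- numbers, and these factors add up to `m + 2`.
    nth_rewrite 1 [← Nat.sum_antidiagonal_swap]
    rw [← sum_add_distrib]
    refine sum_congr rfl fun z hz => ?_
    rw [← HasAntidiagonal.mem_antidiagonal.1 hz, ← succ_mul_catalan_eq_centralBinom,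
      ← succ_mul_catalan_eq_centralBinom]
    simp only [Prod.fst_swap, Prod.snd_swap]
    ring
  have h2 := succ_mul_catalan_eq_centralBinom (m + 1)
  rw [centralBinom_succ_eq] at h2
  rw [show m + 1 + 1 = m + 2 by ring] at h2
  omega

/-- A convolution with a sequence supported on the even numbers. -/
lemma sum_antidiagonal_even {R : Type*} [CommRing R] (f g : ℕ → R) (hg : ∀ k, g (2 * k + 1) = 0)
    (m e : ℕ) (he : e < 2) :
    ∑ z ∈ antidiagonal (2 * m + e), f z.1 * g z.2 =
      ∑ z ∈ antidiagonal m, f (2 * z.1 + e) * g (2 * z.2) := by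
  symm
  refine sum_of_injOn (fun z => (2 * z.1 + e, 2 * z.2)) ?_ ?_ ?_ fun _ _ => rfl
  · rintro ⟨a, b⟩ - ⟨c, d⟩ - h
    simp only [Prod.mk.injEq] at h
    ext <;> simp only <;> omega
  · rintro ⟨a, b⟩ h
    simp only [mem_coe, HasAntidiagonal.mem_antidiagonal] at *
    omega
  · rintro ⟨a, b⟩ h hn
    rcases Nat.even_or_odd' b with ⟨k, rfl | rfl⟩
    · refine absurd ⟨((a - e) / 2, k), ?_, ?_⟩ hn
      · simp only [mem_coe, HasAntidiagonal.mem_antidiagonal] at *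
        omega
      · rw [HasAntidiagonal.mem_antidiagonal] at h
        refine Prod.ext ?_ rfl
        simp only at h ⊢
        omega
    · simp [hg]

lemma ncSum_one {R : Type*} [CommRing R] {p : ℤ → Prop} [DecidablePred p]
    (hs : SignInvariant p) (hp : ∀ v, 0 < v → p v) (x : R) :
    ncSum p x 1 = if p 0 then x else 0 := by
  rw [ncSum_succ hs hp 0 x, ncSum_zero]
  simp

lemma ncSum_add_two {R : Type*} [CommRing R] {p : ℤ → Prop} [DecidablePred p]
    (hs : SignInvariant p) (hp : ∀ v, 0 < v → p v) (n : ℕ) (x : R) :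
    ncSum p x (n + 2) = (if p 0 then x * ncSum (fun j => 0 < j) x (n + 1) else 0) +
      (if p (-1) then 2 else 1) * x *
        ∑ z ∈ antidiagonal n, ncSum p x z.1 * ncSum (fun j => 0 < j) x z.2 := by
  rw [ncSum_succ hs hp (n + 1) x, Nat.sum_antidiagonal_eq_sum_range_succ_mk]
  rfl

lemma ncSum_pos_odd {R : Type*} [CommRing R] (x : R) (m : ℕ) :
    ncSum (fun j => 0 < j) x (2 * m + 1) = 0 := by
  induction m using Nat.strong_induction_on with
  | _ m ih =>
    rcases m with - | m
    · rw [ncSum_one signInvariant_pos fun _ h => h]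
      simp
    · rw [show 2 * (m + 1) + 1 = 2 * m + 1 + 2 by ring,
        ncSum_add_two signInvariant_pos fun _ h => h, sum_eq_zero]
      · simp
      · rintro ⟨a, b⟩ h
        rw [HasAntidiagonal.mem_antidiagonal] at h
        rcases Nat.even_or_odd' b with ⟨k, rfl | rfl⟩
        · have := ih (m - k) (by omega)
          rw [show 2 * (m - k) + 1 = a by simp only at h; omega] at this
          rw [this, zero_mul]
        · rw [ih k (by simp only at h; omega), mul_zero]

lemma ncSum_pos_even {R : Type*} [CommRing R] (x : R) (m : ℕ) :
    ncSum (fun j => 0 < j) x (2 * m) = catalan m * x ^ m := by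
  induction m using Nat.strong_induction_on with
  | _ m ih =>
    rcases m with - | m
    · simp [ncSum_zero]
    · rw [show 2 * (m + 1) = 2 * m + 2 by ring, ncSum_add_two signInvariant_pos fun _ h => h]
      have := sum_antidiagonal_even (ncSum (fun j => 0 < j) x) _ (ncSum_pos_odd x) m 0
        (by norm_num)
      simp only [add_zero] at this
      rw [this, catalan_succ', Nat.cast_sum, sum_mul]
      simp only [lt_self_iff_false, if_false, zero_add, Int.neg_pos, Int.reduceLT, one_mul,
        mul_sum]
      refine sum_congr rfl fun z hz => ?_
      rw [HasAntidiagonal.mem_antidiagonal] at hz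
      rw [ih z.1 (by omega), ih z.2 (by omega), ← hz]
      push_cast
      ring

/-- For conditions allowing negative sources, the even terms are central binomial
coefficients. -/
lemma ncSum_even {R : Type*} [CommRing R] {p : ℤ → Prop}
    (hs : SignInvariant p) (hp : ∀ v, 0 < v → p v) (hneg : p (-1)) (x : R) (m : ℕ) :
    ncSum p x (2 * m) = Nat.centralBinom m * x ^ m := by
  classical
  induction m using Nat.strong_induction_on with
  | _ m ih =>
    rcases m with - | m
    · simp [ncSum_zero]
    · rw [show 2 * (m + 1) = 2 * m + 2 by ring, ncSum_add_two hs hp, ncSum_pos_odd, if_pos hneg]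
      have := sum_antidiagonal_even (ncSum p x) _ (ncSum_pos_odd x) m 0 (by norm_num)
      simp only [add_zero] at this
      rw [this, centralBinom_succ_eq, ← sum_centralBinom_mul_catalan]
      simp only [mul_zero, ite_self, zero_add, mul_sum, Nat.cast_sum, sum_mul]
      refine sum_congr rfl fun z hz => ?_
      rw [HasAntidiagonal.mem_antidiagonal] at hz
      rw [ih z.1 (by omega), ncSum_pos_even, ← hz]
      push_cast
      ring

lemma ncSum_ne_odd {R : Type*} [CommRing R] (x : R) (m : ℕ) :
    ncSum (fun i => i ≠ 0) x (2 * m + 1) = 0 := by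
  induction m using Nat.strong_induction_on with
  | _ m ih =>
    rcases m with - | m
    · rw [ncSum_one signInvariant_ne fun _ h => h.ne']
      simp
    · rw [show 2 * (m + 1) + 1 = 2 * m + 1 + 2 by ring,
        ncSum_add_two signInvariant_ne fun _ h => h.ne',
        sum_antidiagonal_even _ _ (ncSum_pos_odd x) m 1 (by norm_num), sum_eq_zero]
      · simp
      · intro z hz
        rw [HasAntidiagonal.mem_antidiagonal] at hz
        rw [ih z.1 (by omega), zero_mul]

/-- The arc from 0 contributes `catalan (m + 1)`, the first term of the convolution of central
binomials with Catalan numbers; the arcs from nonzero sources supply the remaining terms. -/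
lemma ncSum_true_odd {R : Type*} [CommRing R] (x : R) (m : ℕ) :
    ncSum (fun _ => True) x (2 * m + 1) = (2 * m + 1).choose m * x ^ (m + 1) := by
  induction m using Nat.strong_induction_on with
  | _ m ih =>
    rcases m with - | m
    · rw [ncSum_one signInvariant_true fun _ _ => trivial]
      simp
    · rw [show 2 * (m + 1) + 1 = 2 * m + 1 + 2 by ring,
        ncSum_add_two signInvariant_true fun _ _ => trivial,
        sum_antidiagonal_even _ _ (ncSum_pos_odd x) m 1 (by norm_num),
        show 2 * m + 1 + 1 = 2 * (m + 1) by ring, ncSum_pos_even,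
        show 2 * m + 1 + 2 = 2 * (m + 1) + 1 by ring, ← sum_centralBinom_mul_catalan,
        Nat.sum_antidiagonal_succ]
      simp only [if_true, Nat.centralBinom_zero, one_mul]
      push_cast
      rw [add_mul, mul_sum, sum_mul]
      congr 1
      · ring
      · refine sum_congr rfl fun z hz => ?_
        rw [HasAntidiagonal.mem_antidiagonal] at hz
        rw [ih z.1 (by omega), ncSum_pos_even, centralBinom_succ_eq, ← hz]
        push_cast
        ring

end SetPart

theorem corollary6p6 {R : Type*} [CommRing R] (x y : R) (n : ℕ) :
    (∑ k ∈ Finset.range (n + 1),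
        (-1 : R) ^ (n - k) * (n.choose k : R) * (y + 1) ^ (n - k) * SetPart.BellB k x y
      = SetPart.Fe n (2 * x)) ∧
    (∑ k ∈ Finset.range (n + 1),
        (-1 : R) ^ (n - k) * (n.choose k : R) * (y + 1) ^ (n - k) * SetPart.BellD (k + 1) x y
      = SetPart.FeTildeB n x) ∧
    (∑ k ∈ Finset.range (n + 1),
        (-1 : R) ^ (n - k) * (n.choose k : R) * (y + 1) ^ (n - k) * SetPart.CatB k x y
      = if Even n then (n.choose (n / 2) : R) * x ^ (n / 2) else 0) ∧
    (∑ k ∈ Finset.range (n + 1),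
        (-1 : R) ^ (n - k) * (n.choose k : R) * (y + 1) ^ (n - k) * SetPart.CatD (k + 1) x y
      = (n.choose (n / 2) : R) * x ^ ((n + 1) / 2)) := by
  have hne : ∀ v : ℤ, 0 < v → v ≠ 0 := fun _ h => h.ne'
  have htrue : ∀ v : ℤ, 0 < v → True := fun _ _ => trivial
  simp only [SetPart.BellB_eq, SetPart.BellD_eq, SetPart.CatB_eq, SetPart.CatD_eq,
    SetPart.sum_weakSum SetPart.signInvariant_ne hne,
    SetPart.sum_weakSum SetPart.signInvariant_true htrue]
  refine ⟨?_, (SetPart.FeTildeB_eq n x).symm, ?_, ?_⟩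
  · rw [SetPart.Fe_eq, SetPart.admSum_ne_eq]
  · rw [← SetPart.ncSum]
    rcases Nat.even_or_odd' n with ⟨m, rfl | rfl⟩
    · rw [SetPart.ncSum_even SetPart.signInvariant_ne hne (by decide), if_pos (even_two_mul m),
        Nat.mul_div_cancel_left m two_pos, Nat.centralBinom]
    · rw [SetPart.ncSum_ne_odd, if_neg (Nat.not_even_iff_odd.2 (odd_two_mul_add_one m))]
  · rw [← SetPart.ncSum]
    rcases Nat.even_or_odd' n with ⟨m, rfl | rfl⟩
    · rw [SetPart.ncSum_even SetPart.signInvariant_true htrue trivial,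
        Nat.mul_div_cancel_left m two_pos, Nat.centralBinom,
        show (2 * m + 1) / 2 = m by omega]
    · rw [SetPart.ncSum_true_odd, show (2 * m + 1) / 2 = m by omega,
        show (2 * m + 1 + 1) / 2 = m + 1 by omega]
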